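/- **Setting.** Let $\sigma(t)=\max\{t,0\}$ and consider the weight-normalized two-layer network $$f(\mathbf x)=\frac1{\sqrt m}\sum_{k=1}^m c_k\,\sigma\Big(g_k\frac{\mathbf v_k^\top\mathbf x}{\|\mathbf v_k\|_2}\Big),\qquad \mathbf x,\mathbf v_k\in\mathbb R^d,\ g_k,c_k\in\mathbb R,$$ with training data $(\mathbf x_i,y_i)_{i=1}^n$, $n\ge 1$, $d\ge 50$, where $0<\|\mathbf x_i\|_2\le 1$, no two distinct $\mathbf x_i,\mathbf x_j$ are parallel, and $|y_i|\le M$. For $\alpha\ge 1$ initialize, independently over $k$, $\mathbf v_k(0)\sim N(0,\alpha^2\mathbf I)$, $c_k$ uniform on $\{1,-1\}$ (independent of the $\mathbf v_k(0)$), and $g_k(0)=\|\mathbf v_k(0)\|_2/\alpha$. Keep $c$ fixed and run gradient descent with constant step size $\eta>0$ on $(\mathbf v_k,g_k)_k$ for the loss $\frac12\sum_i(f(\mathbf x_i)-y_i)^2$: writing $f_i=f(\mathbf x_i)$, $\mathbb 1_{ik}=\mathbb 1\{\mathbf v_k^\top\mathbf x_i\ge0\}$, and $\mathbf x^{\mathbf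 v}$, $\mathbf x^{\mathbf v^\perp}$ for the projections of $\mathbf x$ onto $\mathbf v$ and its orthogonal complement, the gradients used are $$\partial_{\mathbf v_k}L=\frac1{\sqrt m}\sum_i(f_i-y_i)\frac{c_kg_k}{\|\mathbf v_k\|_2}\mathbf x_i^{\mathbf v_k^\perp}\mathbb 1_{ik},\qquad \partial_{g_k}L=\frac1{\sqrt m}\sum_i(f_i-y_i)\frac{c_k}{\|\mathbf v_k\|_2}\sigma(\mathbf v_k^\top\mathbf x_i).$$ Let $\mathbf f(s)$ be the vector of predictions after $s$ steps, and let $\mathbf\Lambda(s)=\frac1{\alpha^2}\mathbf V(s)+\mathbf G(s)$, where, evaluated at the parameters after $s$ steps, $$\mathbf V_{ij}=\frac1m\sum_k\Big(\frac{\alpha c_kg_k}{\|\mathbf v_k\|_2}\Big)^2\big\langle\mathbf x_i^{\mathbf v_k^\perp},\mathbf x_j^{\mathbf v_k^\perp}\big\rangle\mathbb 1_{ik}\mathbb 1_{jk},\qquad \mathbf G_{ij}=\frac1m\sum_k\frac{\sigma(\mathbf v_k^\top\mathbf x_i)\,\sigma(\mathbf v_k^\top\mathbf x_j)}{\|\mathbf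 v_k\|_2^2}.$$ Let $\mathbf G^\infty_{ij}=\mathbb E_{\mathbf v\sim N(0,\alpha^2\mathbf I)}\langle\mathbf x_i^{\mathbf v},\mathbf x_j^{\mathbf v}\rangle\mathbb 1\{\mathbf v^\top\mathbf x_i\ge0\}\mathbb 1\{\mathbf v^\top\mathbf x_j\ge0\}$ and $\mu_0=\lambda_{\min}(\mathbf G^\infty)$. **Theorem ($\mathbf G$-dominated convergence).** There is an absolute constant $c_0>0$, and for all $M$ and $\kappa>0$ there is a constant $C>0$ depending only on $M$ and $\kappa$, such that the following holds for all data as above, all $\alpha\ge1$, all $\delta\in(0,1)$ with $2\delta\le n$, and all $K\ge 1$ with $(m/\delta)^{1/d}\le K$. One has $0<\mu_0$ and $\sqrt{n/\mu_0}\ge 1$. Suppose that either $$m\ \ge\ C K^2\max\Big\{\frac{n^4\log(n/\delta)}{\alpha^4\mu_0^4},\ \frac{n^2\log(n/\delta)}{\mu_0^2}\Big\},$$ or $\alpha\ge\kappa\sqrt{n/\mu_0}$ (for example $\alpha=\sqrt{n/\mu_0}$, with $\kappa=1$) and only $$m\ \ge\ C K^2\,\frac{n^2\log(n/\delta)}{\mu_0^2}.$$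 Then with probability at least $1-\delta$ over the initialization, for every step size $0<\eta\le c_0/\|\mathbf\Lambda(0)\|_2$ (in particular for every $\eta>0$ with $\eta\le c_0/\|\mathbf\Lambda(t)\|_2$ for all $t$), and for all iterations $s=0,1,2,\dots$: 1. $\lambda_{\min}(\mathbf\Lambda(s))\ge \mu_0/2$; 2. $\|\mathbf f(s)-\mathbf y\|_2^2\le\big(1-\frac{\eta\mu_0}2\big)^s\,\|\mathbf f(0)-\mathbf y\|_2^2$. -/

import Mathlib

open MeasureTheory ProbabilityTheory

noncomputable section

namespace WeightNorm

/-- The ReLU activation. -/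
def relu (t : ℝ) : ℝ := max t 0

/-- The indicator `1{bᵀx ≥ 0}`. -/
def act {d : ℕ} (b x : EuclideanSpace ℝ (Fin d)) : ℝ :=
  if 0 ≤ inner ℝ b x then 1 else 0

/-- The orthogonal projection `x^u = u uᵀ x / ‖u‖²` of `x` onto the direction of `u`. -/
def alignedPart {d : ℕ} (u x : EuclideanSpace ℝ (Fin d)) : EuclideanSpace ℝ (Fin d) :=
  (inner ℝ u x / ‖u‖ ^ 2) • u

/-- The projection `x^{u⊥} = (I - u uᵀ / ‖u‖²) x` of `x` onto the orthogonal complement of `u`. -/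
def orthPart {d : ℕ} (u x : EuclideanSpace ℝ (Fin d)) : EuclideanSpace ℝ (Fin d) :=
  x - alignedPart u x

/-- The trainable parameters: directions `b_k` and lengths `g_k` of the `m` hidden units. -/
structure Params (d m : ℕ) where
  b : Fin m → EuclideanSpace ℝ (Fin d)
  g : Fin m → ℝ

/-- The weight-normalized two-layer ReLU network
`f(x) = (1/√m) ∑ₖ cₖ σ(gₖ bₖᵀx / ‖bₖ‖)`. -/
def network {d m : ℕ} (c : Fin m → ℝ) (w : Params d m) (z : EuclideanSpace ℝ (Fin d)) : ℝ :=
  1 / √(m : ℝ) * ∑ k, c k * relu (w.g k * (inner ℝ (w.b k) z / ‖w.b k‖))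

/-- The vector of predictions on the training inputs. -/
def predictions {n d m : ℕ} (x : Fin n → EuclideanSpace ℝ (Fin d)) (c : Fin m → ℝ)
    (w : Params d m) : EuclideanSpace ℝ (Fin n) :=
  WithLp.toLp 2 fun i => network c w (x i)

/-- The gradient in `b_k` of the square loss `½ ∑ᵢ (f(xᵢ) - yᵢ)²`, with `σ'(0) = 1`. -/
def gradB {n d m : ℕ} (x : Fin n → EuclideanSpace ℝ (Fin d)) (y : EuclideanSpace ℝ (Fin n))
    (c : Fin m → ℝ) (w : Params d m) (k : Fin m) : EuclideanSpace ℝ (Fin d) :=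
  (1 / √(m : ℝ)) • ∑ i, ((network c w (x i) - y i) * (c k * w.g k / ‖w.b k‖) *
    act (w.b k) (x i)) • orthPart (w.b k) (x i)

/-- The partial derivative in `g_k` of the square loss `½ ∑ᵢ (f(xᵢ) - yᵢ)²`. -/
def gradG {n d m : ℕ} (x : Fin n → EuclideanSpace ℝ (Fin d)) (y : EuclideanSpace ℝ (Fin n))
    (c : Fin m → ℝ) (w : Params d m) (k : Fin m) : ℝ :=
  1 / √(m : ℝ) * ∑ i, (network c w (x i) - y i) * (c k / ‖w.b k‖) *
    relu (inner ℝ (w.b k) (x i))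

/-- One step of gradient descent with step size `η`; the outer weights `c` stay fixed. -/
def gdStep {n d m : ℕ} (η : ℝ) (x : Fin n → EuclideanSpace ℝ (Fin d))
    (y : EuclideanSpace ℝ (Fin n)) (c : Fin m → ℝ) (w : Params d m) : Params d m where
  b k := w.b k - η • gradB x y c w k
  g k := w.g k - η * gradG x y c w k

/-- The parameters at initialization, `g_k(0) = ‖b_k(0)‖ / α`, given the directions `b_k(0)`. -/
def initParams {d m : ℕ} (α : ℝ) (b₀ : Fin m → EuclideanSpace ℝ (Fin d)) : Params d m where
  b := b₀
  g k := ‖b₀ k‖ / α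

/-- The parameters after `s` steps of gradient descent. -/
def iter {n d m : ℕ} (α η : ℝ) (x : Fin n → EuclideanSpace ℝ (Fin d))
    (y : EuclideanSpace ℝ (Fin n)) (b₀ : Fin m → EuclideanSpace ℝ (Fin d)) (c : Fin m → ℝ)
    (s : ℕ) : Params d m :=
  (gdStep η x y c)^[s] (initParams α b₀)

/-- The Gram matrix `V` of the orthogonal components. -/
def gramV {n d m : ℕ} (α : ℝ) (x : Fin n → EuclideanSpace ℝ (Fin d)) (c : Fin m → ℝ)
    (w : Params d m) : Matrix (Fin n) (Fin n) ℝ :=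
  Matrix.of fun i j => 1 / (m : ℝ) * ∑ k, (α * c k * w.g k / ‖w.b k‖) ^ 2 *
    inner ℝ (orthPart (w.b k) (x i)) (orthPart (w.b k) (x j)) *
    act (w.b k) (x i) * act (w.b k) (x j)

/-- The Gram matrix `G` of the aligned components. -/
def gramG {n d m : ℕ} (x : Fin n → EuclideanSpace ℝ (Fin d)) (w : Params d m) :
    Matrix (Fin n) (Fin n) ℝ :=
  Matrix.of fun i j => 1 / (m : ℝ) * ∑ k,
    relu (inner ℝ (w.b k) (x i)) * relu (inner ℝ (w.b k) (x j)) / ‖w.b k‖ ^ 2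

/-- The evolution matrix `Λ = V / α² + G`. -/
def evolution {n d m : ℕ} (α : ℝ) (x : Fin n → EuclideanSpace ℝ (Fin d)) (c : Fin m → ℝ)
    (w : Params d m) : Matrix (Fin n) (Fin n) ℝ :=
  (1 / α ^ 2) • gramV α x c w + gramG x w

/-- The law `N(0, α² I)` on `ℝᵈ`. -/
def gaussian (d : ℕ) (α : ℝ) : Measure (EuclideanSpace ℝ (Fin d)) :=
  (stdGaussian (EuclideanSpace ℝ (Fin d))).map fun v => α • v

/-- The uniform law on `{1, -1}`. -/
def rademacher : Measure ℝ :=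
  (2⁻¹ : ENNReal) • Measure.dirac 1 + (2⁻¹ : ENNReal) • Measure.dirac (-1)

/-- The law of the random initialization `(b(0), c)`: all `b_k(0)` and `c_k` are independent,
`b_k(0) ∼ N(0, α² I)`, and `c_k` is uniform on `{1, -1}`. -/
def initLaw (d m : ℕ) (α : ℝ) :
    Measure ((Fin m → EuclideanSpace ℝ (Fin d)) × (Fin m → ℝ)) :=
  (Measure.pi fun _ => gaussian d α).prod (Measure.pi fun _ => rademacher)

/-- The infinite-width Gram matrix `G^∞`. -/
def gramGInf {n d : ℕ} (α : ℝ) (x : Fin n → EuclideanSpace ℝ (Fin d)) :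
    Matrix (Fin n) (Fin n) ℝ :=
  Matrix.of fun i j => ∫ b, inner ℝ (alignedPart b (x i)) (alignedPart b (x j)) *
    act b (x i) * act b (x j) ∂(gaussian d α)

/-- The least eigenvalue of a (nonempty, symmetric) real matrix. -/
def leastEigenvalue {n : ℕ} (A : Matrix (Fin n) (Fin n) ℝ) : ℝ := sInf (spectrum ℝ A)

/-- The spectral norm of a real matrix. -/
def spectralNorm {n : ℕ} (A : Matrix (Fin n) (Fin n) ℝ) : ℝ :=
  ‖Matrix.toEuclideanCLM (n := Fin n) (𝕜 := ℝ) A‖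

end WeightNorm

end

/-! The matrix `Λ` is the Gram matrix of the vectors `feat x w i`, the derivatives of the
predictions in all parameters, so `⟨a, Λa⟩ = ‖∑ aᵢ feat x w i‖²`. To first order a gradient step
sends the residual `u` to `u - ηΛu`, which shrinks `u` when `Λ` is bounded below and `η‖Λ‖ ≤ 1/2`
(`norm_sub_gram_sq_le`). It remains to keep both properties along the trajectory and to absorb the
linearization error.

The lower bound comes from `G` alone. Its features are Lipschitz in the relative displacement of the
directions (`abs_relu_div_sub_le`), even where activations flip, and `V` is positive semidefinite
and can be dropped. `V` matters only for the upper bound and the linearization error. There flips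
are harmless because few neurons start close enough to a hyperplane `xᵢ⊥` to cross it (`unstable`).
Direction gradients are orthogonal to the directions, so norms never decrease and relative
displacements stay controlled by the initial norms.

The trajectory stays near initialization because a step moves each length by at most `η√n‖u‖/√m`,
while `‖u‖` contracts by `1 - ημ/3`. The total movement is thus at most `R = 3√n U/(√m μ)`, where
`U` bounds the initial residual (`GoodInit.converges`). The width condition makes `R` small enough
for every perturbation estimate (`regime_of_width`).

Probability enters only through `exists_goodInit_event`: small-ball bounds for the norms, Hoeffding
bounds for the Gram entries and the unstable neurons, and sub-Gaussian bounds for the initial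
outputs. Positivity of `μ₀` is the linear independence of ReLU ridge functions along non-parallel
directions (`eq_zero_of_sum_relu_eq_zero`). -/

noncomputable section

namespace WeightNorm

/-! ### Gram matrices, quadratic forms and extreme eigenvalues -/

section LinearAlgebra

variable {n : ℕ} {H : Type*} [NormedAddCommGroup H] [InnerProductSpace ℝ H]

theorem norm_sum_smul_sq_le (a : EuclideanSpace ℝ (Fin n)) (φ : Fin n → H) {δ : ℝ}
    (h : ∀ i, ‖φ i‖ ^ 2 ≤ δ) : ‖∑ i, a i • φ i‖ ^ 2 ≤ n * δ * ‖a‖ ^ 2 := by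
  have h1 : ‖∑ i, a i • φ i‖ ≤ ∑ i, |a i| * ‖φ i‖ :=
    (norm_sum_le _ _).trans (Finset.sum_le_sum fun i _ => by rw [norm_smul, Real.norm_eq_abs])
  calc ‖∑ i, a i • φ i‖ ^ 2 ≤ (∑ i, |a i| * ‖φ i‖) ^ 2 := by gcongr
    _ ≤ (∑ i, |a i| ^ 2) * ∑ i, ‖φ i‖ ^ 2 := Finset.sum_mul_sq_le_sq_mul_sq _ _ _
    _ ≤ (∑ i, |a i| ^ 2) * ∑ _i : Fin n, δ := by
        gcongr with i
        exact h i
    _ = n * δ * ‖a‖ ^ 2 := by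
        rw [EuclideanSpace.real_norm_sq_eq]
        simp
        ring

theorem norm_sum_smul_sub_sq_le (a : EuclideanSpace ℝ (Fin n)) (φ ψ : Fin n → H) {δ : ℝ}
    (h : ∀ i, ‖φ i - ψ i‖ ^ 2 ≤ δ) :
    ‖∑ i, a i • φ i - ∑ i, a i • ψ i‖ ^ 2 ≤ n * δ * ‖a‖ ^ 2 := by
  rw [← Finset.sum_sub_distrib]
  simp_rw [← smul_sub]
  exact norm_sum_smul_sq_le a _ h

/-- Young's inequality, weighted so that little of a lower bound is lost: it turns `7/8 μ` at
initialization into `5/8 μ` nearby. -/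
theorem norm_sq_le_add_mul_norm_sub_sq {F : Type*} [SeminormedAddCommGroup F] (p q : F) :
    ‖q‖ ^ 2 ≤ 5 / 4 * ‖p‖ ^ 2 + 5 * ‖p - q‖ ^ 2 := by
  have h : ‖q‖ ≤ ‖p‖ + ‖p - q‖ := by
    exact norm_le_norm_add_norm_sub p q
  nlinarith [norm_nonneg q, norm_nonneg p, norm_nonneg (p - q), sq_nonneg (‖p‖ - 4 * ‖p - q‖)]

theorem norm_sq_le_two_mul_add {F : Type*} [SeminormedAddCommGroup F] (p q : F) :
    ‖p‖ ^ 2 ≤ 2 * ‖q‖ ^ 2 + 2 * ‖p - q‖ ^ 2 := by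
  have h : ‖p‖ ≤ ‖q‖ + ‖p - q‖ := norm_le_norm_add_norm_sub' p q
  nlinarith [norm_nonneg q, norm_nonneg p, norm_nonneg (p - q), sq_nonneg (‖q‖ - ‖p - q‖)]

/-- One gradient step on a quadratic with Gram matrix `⟨φ i, φ j⟩` contracts the residual. -/
theorem norm_sub_gram_sq_le (φ : Fin n → H) (u : EuclideanSpace ℝ (Fin n)) {L μ η : ℝ}
    (hη : 0 ≤ η) (hL : ∀ a : EuclideanSpace ℝ (Fin n), ‖∑ i, a i • φ i‖ ^ 2 ≤ L * ‖a‖ ^ 2)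
    (hμ : μ * ‖u‖ ^ 2 ≤ ‖∑ i, u i • φ i‖ ^ 2) (hηL : η * L ≤ 1 / 2) :
    ‖u - η • WithLp.toLp 2 (fun i => ∑ j, inner ℝ (φ i) (φ j) * u j)‖ ^ 2 ≤
      (1 - 3 / 2 * η * μ) * ‖u‖ ^ 2 := by
  set v : H := ∑ i, u i • φ i with hv
  set w : EuclideanSpace ℝ (Fin n) :=
    WithLp.toLp 2 (fun i => ∑ j, inner ℝ (φ i) (φ j) * u j) with hw
  have hwi : ∀ i, w i = inner ℝ (φ i) v := fun i => by
    simp [hw, hv, inner_sum, inner_smul_right, mul_comm]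
  have huw : inner ℝ u w = ‖v‖ ^ 2 := by
    rw [← real_inner_self_eq_norm_sq]
    conv_rhs => rw [hv, sum_inner]
    rw [PiLp.inner_apply]
    refine Finset.sum_congr rfl fun i _ => ?_
    rw [hwi, inner_smul_left, ← hv]
    simp [mul_comm]
  have hww : ‖w‖ ^ 2 = inner ℝ (∑ i, w i • φ i) v := by
    rw [EuclideanSpace.real_norm_sq_eq, sum_inner]
    refine Finset.sum_congr rfl fun i _ => ?_
    rw [inner_smul_left, ← hwi]
    simp [sq]
  -- The adjoint of `a ↦ ∑ aᵢ φᵢ` obeys the same norm bound as the map itself. With `ηL ≤ 1/2` the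
  -- quadratic term then eats at most a quarter of the linear gain `2η‖v‖²`.
  have hwL : ‖w‖ ^ 2 ≤ L * ‖v‖ ^ 2 := by
    have h1 : ‖w‖ ^ 2 ≤ ‖∑ i, w i • φ i‖ * ‖v‖ := hww ▸ real_inner_le_norm _ _
    have h2 : (‖w‖ ^ 2) ^ 2 ≤ L * ‖w‖ ^ 2 * ‖v‖ ^ 2 :=
      calc (‖w‖ ^ 2) ^ 2 ≤ (‖∑ i, w i • φ i‖ * ‖v‖) ^ 2 := by gcongr
        _ = ‖∑ i, w i • φ i‖ ^ 2 * ‖v‖ ^ 2 := by ring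
        _ ≤ _ := by gcongr; exact hL w
    rcases eq_or_ne w 0 with h0 | h0
    · have hvu : ‖v‖ ^ 2 = 0 := by rw [← huw, h0, inner_zero_right]
      rw [h0, hvu]; simp
    · have : 0 < ‖w‖ ^ 2 := by positivity
      nlinarith
  rw [norm_sub_sq_real, inner_smul_right, huw, norm_smul, Real.norm_of_nonneg hη]
  have h3 : η ^ 2 * ‖w‖ ^ 2 ≤ η * (η * L) * ‖v‖ ^ 2 := by nlinarith [sq_nonneg η]
  have h4 : η * (η * L) * ‖v‖ ^ 2 ≤ η * (1 / 2) * ‖v‖ ^ 2 := by gcongr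
  have h5 : η * (μ * ‖u‖ ^ 2) ≤ η * ‖v‖ ^ 2 := by gcongr
  nlinarith

theorem norm_sum_smul_sq_eq (φ : Fin n → H) (a : Fin n → ℝ) :
    ‖∑ i, a i • φ i‖ ^ 2 = ∑ i, ∑ j, a i * inner ℝ (φ i) (φ j) * a j := by
  rw [← real_inner_self_eq_norm_sq, sum_inner]
  refine Finset.sum_congr rfl fun i _ => ?_
  rw [inner_smul_left, inner_sum, Finset.mul_sum]
  refine Finset.sum_congr rfl fun j _ => ?_
  rw [inner_smul_right]
  simp
  ring

theorem inner_toEuclideanCLM_eq_sum (A : Matrix (Fin n) (Fin n) ℝ)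
    (a : EuclideanSpace ℝ (Fin n)) :
    inner ℝ a (Matrix.toEuclideanCLM (n := Fin n) (𝕜 := ℝ) A a) =
      ∑ i, ∑ j, a i * A i j * a j := by
  rw [Matrix.inner_toEuclideanCLM]
  simp [Matrix.mulVec, dotProduct, Finset.mul_sum, mul_assoc]

theorem sum_le_spectralNorm (A : Matrix (Fin n) (Fin n) ℝ) (a : EuclideanSpace ℝ (Fin n)) :
    ∑ i, ∑ j, a i * A i j * a j ≤ spectralNorm A * ‖a‖ ^ 2 := by
  rw [← inner_toEuclideanCLM_eq_sum]
  refine (real_inner_le_norm _ _).trans ?_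
  have := (Matrix.toEuclideanCLM (n := Fin n) (𝕜 := ℝ) A).le_opNorm a
  unfold spectralNorm
  nlinarith [norm_nonneg a]

theorem le_leastEigenvalue (hn : 1 ≤ n) {A : Matrix (Fin n) (Fin n) ℝ} (hA : A.IsHermitian)
    {μ : ℝ} (h : ∀ a : EuclideanSpace ℝ (Fin n), μ * ‖a‖ ^ 2 ≤ ∑ i, ∑ j, a i * A i j * a j) :
    μ ≤ leastEigenvalue A := by
  have : Nonempty (Fin n) := ⟨⟨0, hn⟩⟩
  unfold leastEigenvalue
  rw [hA.spectrum_real_eq_range_eigenvalues]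
  refine le_csInf (Set.range_nonempty _) ?_
  rintro _ ⟨k, rfl⟩
  have h1 := h (hA.eigenvectorBasis k)
  rw [← inner_toEuclideanCLM_eq_sum] at h1
  have h2 : Matrix.toEuclideanCLM (n := Fin n) (𝕜 := ℝ) A (hA.eigenvectorBasis k) =
      hA.eigenvalues k • hA.eigenvectorBasis k := by
    ext i
    have := congrFun (hA.mulVec_eigenvectorBasis k) i
    simpa using this
  rw [h2, inner_smul_right, real_inner_self_eq_norm_sq] at h1
  simpa using h1

theorem leastEigenvalue_mul_le {A : Matrix (Fin n) (Fin n) ℝ} (hA : A.IsHermitian)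
    (a : EuclideanSpace ℝ (Fin n)) :
    leastEigenvalue A * ‖a‖ ^ 2 ≤ ∑ i, ∑ j, a i * A i j * a j := by
  have hle : ∀ k, leastEigenvalue A ≤ hA.eigenvalues k := fun k => by
    unfold leastEigenvalue
    rw [hA.spectrum_real_eq_range_eigenvalues]
    exact csInf_le (Set.finite_range _).bddBelow ⟨k, rfl⟩
  have h2 : ∀ k, Matrix.toEuclideanCLM (n := Fin n) (𝕜 := ℝ) A (hA.eigenvectorBasis k) =
      hA.eigenvalues k • hA.eigenvectorBasis k := fun k => by
    ext i
    have := congrFun (hA.mulVec_eigenvectorBasis k) i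
    simpa using this
  rw [← inner_toEuclideanCLM_eq_sum]
  set e := hA.eigenvectorBasis
  have h3 : Matrix.toEuclideanCLM (n := Fin n) (𝕜 := ℝ) A a =
      ∑ k, (inner ℝ (e k) a * hA.eigenvalues k) • e k := by
    conv_lhs => rw [← e.sum_repr' a, map_sum]
    refine Finset.sum_congr rfl fun k _ => ?_
    rw [map_smul, h2, smul_smul]
  rw [h3, inner_sum, ← e.sum_sq_norm_inner_right a, Finset.mul_sum]
  refine Finset.sum_le_sum fun k _ => ?_
  rw [inner_smul_right, Real.norm_eq_abs, sq_abs, real_inner_comm a (e k)]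
  nlinarith [hle k, sq_nonneg (inner ℝ (e k) a : ℝ), real_inner_comm a (e k)]

end LinearAlgebra

/-! ### Perturbation estimates for a single neuron -/

section Neuron

variable {d : ℕ}

theorem relu_nonneg (t : ℝ) : 0 ≤ relu t := le_max_right _ _

theorem relu_mul {s : ℝ} (hs : 0 ≤ s) (t : ℝ) : relu (s * t) = s * relu t := by
  unfold relu
  rw [mul_max_of_nonneg _ _ hs, mul_zero]

theorem abs_relu_sub_le (s t : ℝ) : |relu s - relu t| ≤ |s - t| := by
  unfold relu
  simpa using abs_max_sub_max_le_abs s t 0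

theorem abs_relu_le (t : ℝ) : |relu t| ≤ |t| := by
  simpa [relu] using abs_relu_sub_le t 0

theorem act_nonneg (b x : EuclideanSpace ℝ (Fin d)) : 0 ≤ act b x := by
  unfold act; split_ifs <;> norm_num

theorem act_le_one (b x : EuclideanSpace ℝ (Fin d)) : act b x ≤ 1 := by
  unfold act; split_ifs <;> norm_num

theorem act_mul_inner (b x : EuclideanSpace ℝ (Fin d)) :
    act b x * inner ℝ b x = relu (inner ℝ b x) := by
  unfold act relu
  split_ifs with h
  · rw [one_mul, max_eq_left h]
  · rw [zero_mul, max_eq_right (not_le.1 h).le]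

theorem inner_alignedPart_left (b x z : EuclideanSpace ℝ (Fin d)) :
    inner ℝ (alignedPart b x) z = inner ℝ b x * inner ℝ b z / ‖b‖ ^ 2 := by
  rw [alignedPart, inner_smul_left]
  simp
  ring

theorem inner_orthPart_self (b x : EuclideanSpace ℝ (Fin d)) : inner ℝ b (orthPart b x) = 0 := by
  rcases eq_or_ne b 0 with rfl | hb
  · simp
  · rw [orthPart, inner_sub_right, real_inner_comm (alignedPart b x) b, inner_alignedPart_left,
      real_inner_self_eq_norm_sq]
    field_simp
    ring

theorem inner_orthPart_orthPart (b x z : EuclideanSpace ℝ (Fin d)) :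
    inner ℝ (orthPart b x) (orthPart b z) = inner ℝ (orthPart b x) z := by
  conv_lhs => rw [orthPart.eq_def b z, inner_sub_right, alignedPart, inner_smul_right,
    real_inner_comm b, inner_orthPart_self, mul_zero, sub_zero]

theorem norm_orthPart_le (b x : EuclideanSpace ℝ (Fin d)) : ‖orthPart b x‖ ≤ ‖x‖ := by
  have h := real_inner_le_norm (orthPart b x) x
  rw [← inner_orthPart_orthPart, real_inner_self_eq_norm_sq] at h
  rcases (norm_nonneg (orthPart b x)).eq_or_lt with h0 | h0
  · rw [← h0]; exact norm_nonneg x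
  · nlinarith

/-- The difference splits into `(b - b₀)/‖b₀‖` and a multiple of `b` due to the change of norm, each
at most `‖b - b₀‖/‖b₀‖`. Only `‖b₀‖` enters the denominator, so a norm bound at initialization
suffices. -/
theorem norm_normalize_sub_le {b b₀ : EuclideanSpace ℝ (Fin d)} (hb : b ≠ 0) (hb₀ : b₀ ≠ 0) :
    ‖(1 / ‖b‖) • b - (1 / ‖b₀‖) • b₀‖ ≤ 2 * ‖b - b₀‖ / ‖b₀‖ := by
  have h1 : 0 < ‖b‖ := norm_pos_iff.2 hb
  have h2 : 0 < ‖b₀‖ := norm_pos_iff.2 hb₀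
  have h3 : (1 / ‖b‖) • b - (1 / ‖b₀‖) • b₀ =
      (1 / ‖b₀‖) • (b - b₀) + ((‖b₀‖ - ‖b‖) / (‖b‖ * ‖b₀‖)) • b := by
    rw [smul_sub, ← sub_eq_zero]
    have : (1 / ‖b‖) = 1 / ‖b₀‖ + (‖b₀‖ - ‖b‖) / (‖b‖ * ‖b₀‖) := by field_simp; ring
    rw [this, add_smul]
    abel
  rw [h3]
  refine (norm_add_le _ _).trans ?_
  rw [norm_smul, norm_smul, Real.norm_eq_abs, Real.norm_eq_abs,
    abs_of_pos (by positivity : 0 < 1 / ‖b₀‖), abs_div, abs_of_pos (mul_pos h1 h2)]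
  have h4 : |‖b₀‖ - ‖b‖| ≤ ‖b - b₀‖ := by rw [norm_sub_rev]; exact abs_norm_sub_norm_le _ _
  calc 1 / ‖b₀‖ * ‖b - b₀‖ + |‖b₀‖ - ‖b‖| / (‖b‖ * ‖b₀‖) * ‖b‖
      = (‖b - b₀‖ + |‖b₀‖ - ‖b‖|) / ‖b₀‖ := by field_simp
    _ ≤ _ := by gcongr; linarith

theorem alignedPart_eq (b x : EuclideanSpace ℝ (Fin d)) :
    alignedPart b x = (inner ℝ ((1 / ‖b‖) • b) x) • ((1 / ‖b‖) • b) := by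
  rw [alignedPart, inner_smul_left, smul_smul]
  congr 1
  simp
  ring

theorem norm_normalize_le (b : EuclideanSpace ℝ (Fin d)) : ‖(1 / ‖b‖) • b‖ ≤ 1 := by
  rw [norm_smul]
  simp only [one_div, norm_inv, norm_norm]
  exact inv_mul_le_one

theorem norm_orthPart_sub_le {b b₀ x : EuclideanSpace ℝ (Fin d)} (hb : b ≠ 0) (hb₀ : b₀ ≠ 0)
    (hx : ‖x‖ ≤ 1) :
    ‖orthPart b x - orthPart b₀ x‖ ≤ 2 * (2 * ‖b - b₀‖ / ‖b₀‖) := by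
  have h := norm_normalize_sub_le hb hb₀
  have he := norm_normalize_le b
  have he₀ := norm_normalize_le b₀
  rw [orthPart, orthPart, alignedPart_eq b, alignedPart_eq b₀]
  set e := (1 / ‖b‖) • b
  set e₀ := (1 / ‖b₀‖) • b₀
  clear_value e e₀
  have h1 : x - (inner ℝ e x) • e - (x - (inner ℝ e₀ x) • e₀) =
      -((inner ℝ (e - e₀) x) • e + (inner ℝ e₀ x) • (e - e₀)) := by
    rw [inner_sub_left, sub_smul, smul_sub]
    abel
  rw [h1, norm_neg]
  refine (norm_add_le _ _).trans ?_
  rw [norm_smul, norm_smul, Real.norm_eq_abs, Real.norm_eq_abs]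
  have h2 : |inner ℝ (e - e₀) x| ≤ ‖e - e₀‖ * 1 :=
    (abs_real_inner_le_norm _ _).trans (by gcongr)
  have h3 : |inner ℝ e₀ x| ≤ 1 * 1 := (abs_real_inner_le_norm _ _).trans (by gcongr)
  calc |inner ℝ (e - e₀) x| * ‖e‖ + |inner ℝ e₀ x| * ‖e - e₀‖
      ≤ (‖e - e₀‖ * 1) * 1 + (1 * 1) * ‖e - e₀‖ := by gcongr
    _ ≤ _ := by linarith

/-- By homogeneity the quotient is the ReLU of a unit vector's inner product, hence Lipschitz. No
neuron has to be excepted for a flipped activation. -/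
theorem abs_relu_div_sub_le {b b₀ x : EuclideanSpace ℝ (Fin d)} (hb : b ≠ 0) (hb₀ : b₀ ≠ 0)
    (hx : ‖x‖ ≤ 1) :
    |relu (inner ℝ b x) / ‖b‖ - relu (inner ℝ b₀ x) / ‖b₀‖| ≤ 2 * ‖b - b₀‖ / ‖b₀‖ := by
  have key : ∀ b : EuclideanSpace ℝ (Fin d), relu (inner ℝ b x) / ‖b‖ =
      relu (inner ℝ ((1 / ‖b‖) • b) x) := fun b => by
    rw [real_inner_smul_left, relu_mul (by positivity)]
    ring
  rw [key, key]
  refine (abs_relu_sub_le _ _).trans ?_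
  rw [← inner_sub_left]
  refine (abs_real_inner_le_norm _ _).trans ?_
  calc _ ≤ ‖(1 / ‖b‖) • b - (1 / ‖b₀‖) • b₀‖ * 1 := by gcongr
    _ ≤ _ := by rw [mul_one]; exact norm_normalize_sub_le hb hb₀

theorem relu_inner_le (b : EuclideanSpace ℝ (Fin d)) {x : EuclideanSpace ℝ (Fin d)} (hx : ‖x‖ ≤ 1) :
    relu (inner ℝ b x) ≤ ‖b‖ := by
  refine (le_abs_self _).trans ((abs_relu_le _).trans ((abs_real_inner_le_norm _ _).trans ?_))
  nlinarith [norm_nonneg b]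

theorem relu_div_le_one (b : EuclideanSpace ℝ (Fin d)) {x : EuclideanSpace ℝ (Fin d)}
    (hx : ‖x‖ ≤ 1) : relu (inner ℝ b x) / ‖b‖ ≤ 1 :=
  div_le_one_of_le₀ (relu_inner_le b hx) (norm_nonneg b)

/-- The activation pattern can only differ if `x` is nearly orthogonal to `b₀`. -/
theorem act_eq_of_lt_abs_inner {b b₀ x : EuclideanSpace ℝ (Fin d)}
    (h : ‖b - b₀‖ * ‖x‖ < |inner ℝ b₀ x|) :
    act b x = act b₀ x := by
  have h1 := abs_real_inner_le_norm (b - b₀) x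
  rw [inner_sub_left] at h1
  have h2 := abs_le.1 (h1.trans h.le)
  have h3 := abs_lt.1 (h1.trans_lt h)
  unfold act
  congr 1
  rw [eq_iff_iff]
  rcases abs_cases (inner ℝ b₀ x : ℝ) with h4 | h4
  · constructor <;> intro _ <;> linarith
  · constructor <;> intro _ <;> linarith

theorem relu_inner_sub_eq {b b' x : EuclideanSpace ℝ (Fin d)} (h : act b' x = act b x) :
    relu (inner ℝ b' x) - relu (inner ℝ b x) - act b x * inner ℝ (b' - b) x = 0 := by
  rw [← act_mul_inner, ← act_mul_inner, h, inner_sub_left]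
  ring

/-- If the activation flips, the first-order expansion fails, but the error is still of the order of
the step; this is what an unstable neuron costs. Without a flip the remainder is zero
(`relu_inner_sub_eq`). -/
theorem abs_relu_inner_sub_le (b b' : EuclideanSpace ℝ (Fin d)) {x : EuclideanSpace ℝ (Fin d)}
    (hx : ‖x‖ ≤ 1) :
    |relu (inner ℝ b' x) - relu (inner ℝ b x) - act b x * inner ℝ (b' - b) x| ≤ ‖b' - b‖ := by
  have h1 : |inner ℝ (b' - b) x| ≤ ‖b' - b‖ * 1 := (abs_real_inner_le_norm _ _).trans (by gcongr)
  rw [mul_one] at h1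
  refine le_trans ?_ h1
  rw [inner_sub_left]
  unfold relu act
  split_ifs with h
  · rw [max_eq_left h]
    rcases le_total 0 (inner ℝ b' x : ℝ) with h2 | h2
    · rw [max_eq_left h2, one_mul, sub_self, abs_zero]; exact abs_nonneg _
    · rw [max_eq_right h2]
      rw [abs_of_nonpos (by linarith : (inner ℝ b' x : ℝ) - inner ℝ b x ≤ 0), abs_le]
      constructor <;> linarith
  · rw [max_eq_right (not_le.1 h).le]
    rcases le_total 0 (inner ℝ b' x : ℝ) with h2 | h2
    · rw [max_eq_left h2, abs_of_nonneg (by linarith : 0 ≤ (inner ℝ b' x : ℝ) - inner ℝ b x),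
        abs_le]
      constructor <;> linarith
    · rw [max_eq_right h2]
      simp

/-- First-order expansion of a weight-normalized neuron under an update of the direction that is
orthogonal to it. -/
theorem abs_neuron_sub_le {b b' x : EuclideanSpace ℝ (Fin d)} {g g' : ℝ} (hb : b ≠ 0) (hx : ‖x‖ ≤ 1)
    (horth : inner ℝ b (b' - b) = 0) (hg' : 0 ≤ g') :
    |g' * (relu (inner ℝ b' x) / ‖b'‖) - g * (relu (inner ℝ b x) / ‖b‖) -
        ((g' - g) * (relu (inner ℝ b x) / ‖b‖) +
          g / ‖b‖ * (act b x * inner ℝ (b' - b) x))| ≤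
      g' / ‖b'‖ *
          |relu (inner ℝ b' x) - relu (inner ℝ b x) - act b x * inner ℝ (b' - b) x| +
        (|g' - g| * ‖b' - b‖ / ‖b‖ + 3 / 2 * (g' / ‖b'‖ * ‖b' - b‖ ^ 2 / ‖b‖)) := by
  have hN : 0 < ‖b‖ := norm_pos_iff.2 hb
  have hsq : ‖b'‖ ^ 2 = ‖b‖ ^ 2 + ‖b' - b‖ ^ 2 := by
    have := norm_add_sq_real b (b' - b)
    rw [horth, add_sub_cancel] at this
    linarith
  have hNN : ‖b‖ ≤ ‖b'‖ := by
    nlinarith [norm_nonneg b', norm_nonneg b, sq_nonneg ‖b' - b‖]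
  have hN' : 0 < ‖b'‖ := hN.trans_le hNN
  have hB0 := relu_nonneg (inner ℝ b x)
  have hBN := relu_inner_le b hx
  have hl : |act b x * inner ℝ (b' - b) x| ≤ ‖b' - b‖ := by
    rw [abs_mul, abs_of_nonneg (act_nonneg b x)]
    calc _ ≤ 1 * (‖b' - b‖ * 1) := by
          gcongr
          · exact act_le_one b x
          · exact (abs_real_inner_le_norm _ _).trans (by gcongr)
      _ = _ := by ring
  have hdiff : ‖b'‖ - ‖b‖ ≤ ‖b' - b‖ := norm_sub_norm_le b' b
  -- The update is orthogonal to `b`, so by Pythagoras the norm changes only to second order.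
  have hdiff2 : (‖b'‖ - ‖b‖) ≤ ‖b' - b‖ ^ 2 / (2 * ‖b‖) := by
    rw [le_div_iff₀ (by positivity)]
    nlinarith
  set D := ‖b' - b‖ with hD
  set N := ‖b‖ with hNdef
  set N' := ‖b'‖ with hNdef'
  set A := relu (inner ℝ b' x)
  set B := relu (inner ℝ b x)
  set l := act b x * inner ℝ (b' - b) x
  -- An exact identity: the ReLU remainder is isolated, and the other three terms are products of
  -- two small increments or contain the second-order change of the norm.
  have hid : g' * (A / N') - g * (B / N) - ((g' - g) * (B / N) + g / N * l) =
      g' / N' * (A - B - l) + ((g' - g) / N * l - g' / N' * ((N' - N) / N) * l -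
        g' / N' * (B / N) * (N' - N)) := by
    field_simp
    ring
  have hp : 0 ≤ g' / N' := by positivity
  have hD0 : 0 ≤ D := norm_nonneg _
  rw [hid]
  refine (abs_add_le _ _).trans ?_
  rw [abs_mul, abs_of_nonneg hp]
  gcongr
  have t1 : |(g' - g) / N * l| ≤ |g' - g| * D / N := by
    rw [abs_mul, abs_div, abs_of_pos hN, div_mul_eq_mul_div]
    gcongr
  have t2 : |g' / N' * ((N' - N) / N) * l| ≤ g' / N' * (D / N) * D := by
    have : 0 ≤ (N' - N) / N := div_nonneg (by linarith) hN.le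
    rw [abs_mul, abs_of_nonneg (mul_nonneg hp this)]
    gcongr
  have t3 : |g' / N' * (B / N) * (N' - N)| ≤ g' / N' * 1 * (D ^ 2 / (2 * N)) := by
    rw [abs_of_nonneg (mul_nonneg (by positivity) (by linarith))]
    gcongr
    exact div_le_one_of_le₀ hBN hN.le
  have t4 : g' / N' * (D / N) * D + g' / N' * 1 * (D ^ 2 / (2 * N)) =
      3 / 2 * (g' / N' * D ^ 2 / N) := by
    field_simp
    ring
  refine (abs_sub _ _).trans ?_
  refine (add_le_add_left (abs_sub _ _) _).trans ?_
  linarith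

end Neuron

/-! ### Feature vectors, gradient bounds and the linearized step -/

section Features

variable {n d m : ℕ}

/-- Derivative of the `i`-th prediction in the directions, up to the signs `c`. -/
def featV (x : Fin n → EuclideanSpace ℝ (Fin d)) (w : Params d m) (i : Fin n) :
    PiLp 2 (fun _ : Fin m => EuclideanSpace ℝ (Fin d)) :=
  WithLp.toLp 2 fun k =>
    (1 / √(m : ℝ) * (w.g k / ‖w.b k‖ * act (w.b k) (x i))) • orthPart (w.b k) (x i)

/-- Derivative of the `i`-th prediction in the lengths, up to the signs `c`. -/
def featG (x : Fin n → EuclideanSpace ℝ (Fin d)) (w : Params d m) (i : Fin n) :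
    EuclideanSpace ℝ (Fin m) :=
  WithLp.toLp 2 fun k => 1 / √(m : ℝ) * (relu (inner ℝ (w.b k) (x i)) / ‖w.b k‖)

/-- Derivative of the `i`-th prediction in all parameters, up to the signs `c`. -/
def feat (x : Fin n → EuclideanSpace ℝ (Fin d)) (w : Params d m) (i : Fin n) :
    WithLp 2 (PiLp 2 (fun _ : Fin m => EuclideanSpace ℝ (Fin d)) × EuclideanSpace ℝ (Fin m)) :=
  WithLp.toLp 2 (featV x w i, featG x w i)

variable (x : Fin n → EuclideanSpace ℝ (Fin d)) (w : Params d m)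

theorem one_div_sqrt_mul_self (m : ℕ) : 1 / √(m : ℝ) * (1 / √(m : ℝ)) = 1 / (m : ℝ) := by
  rw [div_mul_div_comm, Real.mul_self_sqrt (Nat.cast_nonneg m), one_mul]

theorem inner_feat (i j : Fin n) :
    inner ℝ (feat x w i) (feat x w j) =
      inner ℝ (featV x w i) (featV x w j) + inner ℝ (featG x w i) (featG x w j) := by
  simp [feat, WithLp.prod_inner_apply]

theorem inner_featV (i j : Fin n) :
    inner ℝ (featV x w i) (featV x w j) = 1 / (m : ℝ) * ∑ k, (w.g k / ‖w.b k‖) ^ 2 *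
      inner ℝ (orthPart (w.b k) (x i)) (orthPart (w.b k) (x j)) *
      act (w.b k) (x i) * act (w.b k) (x j) := by
  rw [PiLp.inner_apply, Finset.mul_sum]
  refine Finset.sum_congr rfl fun k _ => ?_
  simp only [featV]
  rw [real_inner_smul_left, real_inner_smul_right, ← one_div_sqrt_mul_self]
  ring

theorem inner_featG (i j : Fin n) :
    inner ℝ (featG x w i) (featG x w j) = gramG x w i j := by
  rw [PiLp.inner_apply, gramG, Matrix.of_apply, Finset.mul_sum]
  refine Finset.sum_congr rfl fun k _ => ?_
  simp only [featG]
  rw [← one_div_sqrt_mul_self]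
  simp only [RCLike.inner_apply, conj_trivial]
  ring

/-- The signs enter only through `c k ^ 2 = 1`, and the `α²` inside `V` cancels the prefactor, so
features without signs suffice. -/
theorem evolution_apply {α : ℝ} (hα : α ≠ 0) {c : Fin m → ℝ} (hc : ∀ k, c k ^ 2 = 1)
    (i j : Fin n) : evolution α x c w i j = inner ℝ (feat x w i) (feat x w j) := by
  rw [inner_feat, inner_featG, inner_featV, evolution, Matrix.add_apply, Matrix.smul_apply,
    gramV, Matrix.of_apply, smul_eq_mul, ← mul_assoc, mul_comm (1 / α ^ 2), mul_assoc,
    Finset.mul_sum]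
  congr 2
  refine Finset.sum_congr rfl fun k _ => ?_
  have : (α * c k * w.g k / ‖w.b k‖) ^ 2 = α ^ 2 * (w.g k / ‖w.b k‖) ^ 2 := by
    rw [mul_div_assoc, mul_pow, mul_pow, hc, mul_one]
  rw [this]
  field_simp

theorem norm_sum_feat_sq (a : Fin n → ℝ) :
    ‖∑ i, a i • feat x w i‖ ^ 2 =
      ‖∑ i, a i • featV x w i‖ ^ 2 + ‖∑ i, a i • featG x w i‖ ^ 2 := by
  simp only [norm_sum_smul_sq_eq, inner_feat, ← Finset.sum_add_distrib]
  refine Finset.sum_congr rfl fun i _ => Finset.sum_congr rfl fun j _ => by ring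

theorem isHermitian_evolution {α : ℝ} (hα : α ≠ 0) {c : Fin m → ℝ} (hc : ∀ k, c k ^ 2 = 1) :
    (evolution α x c w).IsHermitian := by
  ext i j
  rw [Matrix.conjTranspose_apply, evolution_apply x w hα hc, evolution_apply x w hα hc,
    real_inner_comm]
  simp

theorem sum_abs_le (u : EuclideanSpace ℝ (Fin n)) : ∑ i, |u i| ≤ √n * ‖u‖ := by
  have h := Finset.sum_mul_sq_le_sq_mul_sq Finset.univ (fun _ : Fin n => (1 : ℝ)) (fun i => |u i|)
  simp only [one_mul, one_pow, sq_abs, Finset.sum_const, Finset.card_univ, Fintype.card_fin,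
    nsmul_eq_mul, mul_one] at h
  rw [← EuclideanSpace.real_norm_sq_eq] at h
  refine le_of_pow_le_pow_left₀ two_ne_zero (by positivity) ?_
  rw [mul_pow, Real.sq_sqrt (Nat.cast_nonneg n)]
  exact h

theorem norm_le_sqrt_mul {u : EuclideanSpace ℝ (Fin n)} {B : ℝ} (hB : 0 ≤ B)
    (h : ∀ i, |u i| ≤ B) : ‖u‖ ≤ √n * B := by
  refine le_of_pow_le_pow_left₀ two_ne_zero (by positivity) ?_
  rw [EuclideanSpace.real_norm_sq_eq, mul_pow, Real.sq_sqrt (Nat.cast_nonneg n)]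
  calc ∑ i, u i ^ 2 ≤ ∑ _i : Fin n, B ^ 2 := by
        refine Finset.sum_le_sum fun i _ => ?_
        rw [← sq_abs]
        exact pow_le_pow_left₀ (abs_nonneg _) (h i) 2
    _ = n * B ^ 2 := by simp

variable (y : EuclideanSpace ℝ (Fin n)) (c : Fin m → ℝ)

theorem abs_gradG_le (hx : ∀ i, ‖x i‖ ≤ 1) (hc : ∀ k, |c k| = 1) (k : Fin m) :
    |gradG x y c w k| ≤ √n * ‖predictions x c w - y‖ / √m := by
  rw [gradG, abs_mul, abs_of_nonneg (by positivity : 0 ≤ 1 / √(m : ℝ)), div_mul_eq_mul_div, one_mul]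
  gcongr
  refine le_trans ((Finset.abs_sum_le_sum_abs _ _).trans (Finset.sum_le_sum fun i _ => ?_))
    (sum_abs_le (predictions x c w - y))
  rw [mul_assoc, abs_mul, div_mul_eq_mul_div, mul_div_assoc, abs_mul, hc, one_mul,
    abs_of_nonneg (div_nonneg (relu_nonneg _) (norm_nonneg _))]
  exact mul_le_of_le_one_right (abs_nonneg _) (relu_div_le_one _ (hx i))

theorem norm_gradB_le (hx : ∀ i, ‖x i‖ ≤ 1) (hc : ∀ k, |c k| = 1) (k : Fin m) {p : ℝ}
    (hg : 0 ≤ w.g k) (hp : w.g k / ‖w.b k‖ ≤ p) :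
    ‖gradB x y c w k‖ ≤ p * (√n * ‖predictions x c w - y‖ / √m) := by
  have hq : 0 ≤ w.g k / ‖w.b k‖ := by positivity
  have hp0 : 0 ≤ p := hq.trans hp
  rw [gradB, norm_smul, Real.norm_of_nonneg (by positivity : 0 ≤ 1 / √(m : ℝ))]
  calc _ ≤ 1 / √(m : ℝ) * (p * ∑ i, |(predictions x c w - y) i|) := by
        gcongr
        rw [Finset.mul_sum]
        refine (norm_sum_le _ _).trans (Finset.sum_le_sum fun i _ => ?_)
        rw [norm_smul, mul_assoc, norm_mul, Real.norm_eq_abs, Real.norm_eq_abs, abs_mul,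
          mul_div_assoc, abs_mul, hc, one_mul, abs_of_nonneg hq, abs_of_nonneg (act_nonneg _ _)]
        change |(predictions x c w - y) i| * _ * _ ≤ _
        calc _ ≤ |(predictions x c w - y) i| * (p * 1) * 1 := by
              gcongr
              · exact act_nonneg _ _
              · exact act_le_one _ _
              · exact (norm_orthPart_le _ _).trans (hx i)
          _ = _ := by ring
    _ ≤ 1 / √(m : ℝ) * (p * (√n * ‖predictions x c w - y‖)) := by
        gcongr
        exact sum_abs_le _
    _ = _ := by ring

/-- Each summand is a projection onto the complement of `w.b k`. This is the source of the monotone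
growth of the norms. -/
theorem inner_gradB_self (k : Fin m) : inner ℝ (w.b k) (gradB x y c w k) = 0 := by
  rw [gradB, inner_smul_right, inner_sum]
  simp [inner_smul_right, inner_orthPart_self]

/-- The first-order change of the predictions under a gradient step is `-η Λ (f - y)`. -/
theorem linear_part_gdStep (hc : ∀ k, c k ^ 2 = 1) (η : ℝ) (i : Fin n) :
    1 / √(m : ℝ) * ∑ k, c k *
        (((gdStep η x y c w).g k - w.g k) * (relu (inner ℝ (w.b k) (x i)) / ‖w.b k‖) +
          w.g k / ‖w.b k‖ *
            (act (w.b k) (x i) * inner ℝ ((gdStep η x y c w).b k - w.b k) (x i))) =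
      -η * ∑ j, inner ℝ (feat x w i) (feat x w j) * (predictions x c w - y) j := by
  have hG : ∀ k, (gdStep η x y c w).g k - w.g k = -η * gradG x y c w k := fun k => by
    simp [gdStep]
  have hB : ∀ k, inner ℝ ((gdStep η x y c w).b k - w.b k) (x i) =
      -η * inner ℝ (gradB x y c w k) (x i) := fun k => by
    simp [gdStep, inner_smul_left]
  have hu : ∀ j, network c w (x j) - y j = (predictions x c w - y) j := fun j => rfl
  simp only [hG, hB, inner_feat, inner_featG, inner_featV, gradG, gradB, gramG, Matrix.of_apply, hu,
    real_inner_smul_left, sum_inner, Finset.mul_sum, Finset.sum_mul, ← Finset.sum_add_distrib]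
  rw [Finset.sum_comm]
  refine Finset.sum_congr rfl fun j _ => Finset.sum_congr rfl fun k _ => ?_
  -- The gradient contains a projected `x j` paired with an unprojected `x i`; idempotence of the
  -- projection makes the pairing symmetric, as in `V`.
  rw [← inner_orthPart_orthPart (w.b k) (x j) (x i),
    real_inner_comm (orthPart (w.b k) (x i)) (orthPart (w.b k) (x j)), ← one_div_sqrt_mul_self]
  linear_combination (-η * (1 / √(m : ℝ) * (1 / √(m : ℝ))) * (predictions x c w - y) j *
    (relu (inner ℝ (w.b k) (x i)) * relu (inner ℝ (w.b k) (x j)) / ‖w.b k‖ ^ 2 +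
      (w.g k / ‖w.b k‖) ^ 2 * inner ℝ (orthPart (w.b k) (x i)) (orthPart (w.b k) (x j)) *
      act (w.b k) (x i) * act (w.b k) (x j))) * hc k

end Features

/-! ### Conditioning of the evolution matrix near initialization -/

section Descent

variable {n d m : ℕ}

/-- The parameters `w` are within `D` of the initialization with directions `b₀`. -/
structure NearInit (α D : ℝ) (b₀ : Fin m → EuclideanSpace ℝ (Fin d)) (w : Params d m) : Prop where
  g_close : ∀ k, |w.g k - ‖b₀ k‖ / α| ≤ D
  b_close : ∀ k, ‖w.b k - b₀ k‖ ≤ 2 * D / α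
  norm_le : ∀ k, ‖b₀ k‖ ≤ ‖w.b k‖

/-- The neurons whose initial direction is so close to the hyperplane orthogonal to `x i` that
their activation on `x i` may change during training. -/
def unstable (α ρ : ℝ) (x : Fin n → EuclideanSpace ℝ (Fin d))
    (b₀ : Fin m → EuclideanSpace ℝ (Fin d)) (i : Fin n) : Finset (Fin m) :=
  Finset.univ.filter fun k => |inner ℝ (b₀ k) (x i)| ≤ ρ * (α * ‖x i‖)

/-- The properties of a random initialization that make gradient descent converge. -/
structure GoodInit (α τ ρ θ μ U : ℝ) (x : Fin n → EuclideanSpace ℝ (Fin d))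
    (y : EuclideanSpace ℝ (Fin n)) (b₀ : Fin m → EuclideanSpace ℝ (Fin d)) (c : Fin m → ℝ) :
    Prop where
  sign : ∀ k, |c k| = 1
  norm_ge : ∀ k, α * τ ≤ ‖b₀ k‖
  count : ∀ i, ((unstable α ρ x b₀ i).card : ℝ) ≤ θ * m
  gram : ∀ a : EuclideanSpace ℝ (Fin n),
    7 / 8 * μ * ‖a‖ ^ 2 ≤ ∑ i, ∑ j, a i * gramG x (initParams α b₀) i j * a j
  loss : ‖predictions x c (initParams α b₀) - y‖ ≤ U

/-- The relations between the constants that make gradient descent converge. -/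
structure Regime (n m : ℕ) (α τ ρ θ μ R : ℝ) : Prop where
  one_le_n : 1 ≤ n
  one_le_m : 1 ≤ m
  one_le_α : 1 ≤ α
  τ_pos : 0 < τ
  μ_pos : 0 < μ
  μ_le_one : μ ≤ 1
  R_nonneg : 0 ≤ R
  R_le : R ≤ τ
  R_le_mul : n * (R / (α ^ 2 * τ)) ≤ μ / 1000
  θ_le : n * θ ≤ μ / 1000
  R_le_ρ : 2 * R / α ^ 2 ≤ ρ

variable {α τ ρ θ μ U R D : ℝ} {x : Fin n → EuclideanSpace ℝ (Fin d)}
  {y : EuclideanSpace ℝ (Fin n)} {b₀ : Fin m → EuclideanSpace ℝ (Fin d)} {c : Fin m → ℝ}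
  {w w' : Params d m}

theorem NearInit.mono (h : NearInit α D b₀ w) (hα : 0 < α) (hD : D ≤ R) : NearInit α R b₀ w where
  g_close k := (h.g_close k).trans hD
  b_close k := (h.b_close k).trans (by gcongr)
  norm_le := h.norm_le

theorem nearInit_initParams (hα : 0 < α) (hD : 0 ≤ D) : NearInit α D b₀ (initParams α b₀) where
  g_close k := by simpa [initParams] using hD
  b_close k := by
    simp only [initParams, sub_self, norm_zero]
    positivity
  norm_le k := le_rfl

theorem Regime.α_pos (hr : Regime n m α τ ρ θ μ R) : 0 < α := one_pos.trans_le hr.one_le_α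

theorem Regime.m_pos (hr : Regime n m α τ ρ θ μ R) : (0 : ℝ) < m := by exact_mod_cast hr.one_le_m

theorem GoodInit.sign_sq (hg : GoodInit α τ ρ θ μ U x y b₀ c)
    (k : Fin m) : c k ^ 2 = 1 := by rw [← sq_abs, hg.sign, one_pow]

theorem GoodInit.norm_pos (hr : Regime n m α τ ρ θ μ R) (hg : GoodInit α τ ρ θ μ U x y b₀ c)
    (k : Fin m) : 0 < ‖b₀ k‖ :=
  (mul_pos hr.α_pos hr.τ_pos).trans_le (hg.norm_ge k)

theorem GoodInit.ne_zero (hr : Regime n m α τ ρ θ μ R) (hg : GoodInit α τ ρ θ μ U x y b₀ c)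
    (k : Fin m) : b₀ k ≠ 0 := norm_pos_iff.1 (hg.norm_pos hr k)

theorem NearInit.ne_zero (hr : Regime n m α τ ρ θ μ R) (hg : GoodInit α τ ρ θ μ U x y b₀ c)
    (hw : NearInit α R b₀ w)
    (k : Fin m) : w.b k ≠ 0 :=
  norm_pos_iff.1 ((hg.norm_pos hr k).trans_le (hw.norm_le k))

theorem NearInit.g_nonneg (hr : Regime n m α τ ρ θ μ R) (hg : GoodInit α τ ρ θ μ U x y b₀ c)
    (hw : NearInit α R b₀ w)
    (k : Fin m) : 0 ≤ w.g k := by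
  have h1 := (abs_le.1 (hw.g_close k)).1
  have h2 : τ ≤ ‖b₀ k‖ / α := by
    rw [le_div_iff₀ hr.α_pos, mul_comm]; exact hg.norm_ge k
  linarith [hr.R_le]

/-- The ratio starts at `1/α`. The denominator never shrinks, and the length has moved by at most `R
≤ τ ≤ ‖b₀ k‖/α`, so the ratio at most doubles. -/
theorem NearInit.ratio_le (hr : Regime n m α τ ρ θ μ R) (hg : GoodInit α τ ρ θ μ U x y b₀ c)
    (hw : NearInit α R b₀ w)
    (k : Fin m) : w.g k / ‖w.b k‖ ≤ 2 / α := by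
  have h1 := (abs_le.1 (hw.g_close k)).2
  have h2 : τ ≤ ‖b₀ k‖ / α := by
    rw [le_div_iff₀ hr.α_pos, mul_comm]; exact hg.norm_ge k
  have h3 : w.g k ≤ 2 / α * ‖b₀ k‖ := by
    have : 2 / α * ‖b₀ k‖ = 2 * (‖b₀ k‖ / α) := by ring
    linarith [hr.R_le]
  have hα := hr.α_pos
  rw [div_le_iff₀ ((hg.norm_pos hr k).trans_le (hw.norm_le k))]
  exact h3.trans (by gcongr; exact hw.norm_le k)

theorem NearInit.rel_close (hr : Regime n m α τ ρ θ μ R) (hg : GoodInit α τ ρ θ μ U x y b₀ c)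
    (hw : NearInit α R b₀ w)
    (k : Fin m) :
    2 * ‖w.b k - b₀ k‖ / ‖b₀ k‖ ≤ 4 * (R / (α ^ 2 * τ)) := by
  have hα := hr.α_pos
  have hτ := hr.τ_pos
  calc 2 * ‖w.b k - b₀ k‖ / ‖b₀ k‖ ≤ 2 * (2 * R / α) / (α * τ) := by
        have := hr.R_nonneg
        gcongr
        · exact hw.b_close k
        · exact hg.norm_ge k
    _ = _ := by field_simp; ring

/-- The displacement `2R/α` of a direction is at most `ρα`, the margin that stable neurons keep from
the hyperplane orthogonal to `x i`, measured relative to `‖x i‖`. -/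
theorem NearInit.act_eq (hr : Regime n m α τ ρ θ μ R) (hw : NearInit α R b₀ w)
    {k : Fin m} {i : Fin n} (hk : k ∉ unstable α ρ x b₀ i) :
    act (w.b k) (x i) = act (b₀ k) (x i) := by
  refine act_eq_of_lt_abs_inner ?_
  have hk' : ρ * (α * ‖x i‖) < |inner ℝ (b₀ k) (x i)| := by simpa [unstable] using hk
  refine lt_of_le_of_lt ?_ hk'
  have hα := hr.α_pos
  calc ‖w.b k - b₀ k‖ * ‖x i‖ ≤ 2 * R / α * ‖x i‖ := by gcongr; exact hw.b_close k
    _ = 2 * R / α ^ 2 * (α * ‖x i‖) := by field_simp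
    _ ≤ _ := by gcongr; exact hr.R_le_ρ

theorem NearInit.norm_featG_sub_sq_le (hr : Regime n m α τ ρ θ μ R)
    (hg : GoodInit α τ ρ θ μ U x y b₀ c)
    (hw : NearInit α R b₀ w)
    (hx : ∀ i, ‖x i‖ ≤ 1) (i : Fin n) :
    ‖featG x w i - featG x (initParams α b₀) i‖ ^ 2 ≤ (4 * (R / (α ^ 2 * τ))) ^ 2 := by
  have hm := hr.m_pos
  rw [EuclideanSpace.real_norm_sq_eq]
  have h1 : ∀ k, (featG x w i - featG x (initParams α b₀) i) k ^ 2 ≤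
      1 / (m : ℝ) * (4 * (R / (α ^ 2 * τ))) ^ 2 := fun k => by
    simp only [featG, initParams, PiLp.sub_apply]
    rw [← mul_sub, mul_pow, sq (1 / √(m : ℝ)), one_div_sqrt_mul_self, ← sq_abs (_ - _)]
    gcongr
    exact (abs_relu_div_sub_le (hw.ne_zero hr hg k) (hg.ne_zero hr k) (hx i)).trans
      (hw.rel_close hr hg k)
  refine (Finset.sum_le_sum fun k _ => h1 k).trans (le_of_eq ?_)
  rw [Finset.sum_const, Finset.card_univ, Fintype.card_fin, nsmul_eq_mul]
  field_simp

theorem Regime.perturbation_le (hr : Regime n m α τ ρ θ μ R) :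
    n * (4 * (R / (α ^ 2 * τ))) ^ 2 ≤ μ / 10000 := by
  have hα := hr.α_pos
  have hτ := hr.τ_pos
  have hR := hr.R_nonneg
  set q := R / (α ^ 2 * τ)
  have hq : 0 ≤ q := by positivity
  have hn : (1 : ℝ) ≤ n := by exact_mod_cast hr.one_le_n
  have h1 := hr.R_le_mul
  have h2 : n * q ^ 2 ≤ (n * q) ^ 2 := by
    rw [mul_pow]
    gcongr
    nlinarith
  have h3 : (n * q) ^ 2 ≤ (μ / 1000) ^ 2 := by gcongr
  nlinarith [hr.μ_pos, hr.μ_le_one]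

/-- The Gram matrix of the aligned components stays well conditioned near initialization. -/
theorem NearInit.featG_lower (hr : Regime n m α τ ρ θ μ R) (hg : GoodInit α τ ρ θ μ U x y b₀ c)
    (hw : NearInit α R b₀ w)
    (hx : ∀ i, ‖x i‖ ≤ 1) (a : EuclideanSpace ℝ (Fin n)) :
    5 / 8 * μ * ‖a‖ ^ 2 ≤ ‖∑ i, a i • featG x w i‖ ^ 2 := by
  have h1 := hg.gram a
  simp only [← inner_featG] at h1
  rw [← norm_sum_smul_sq_eq] at h1
  have h2 := norm_sq_le_add_mul_norm_sub_sq (∑ i, a i • featG x w i)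
    (∑ i, a i • featG x (initParams α b₀) i)
  have h3 := norm_sum_smul_sub_sq_le a _ _ (hw.norm_featG_sub_sq_le hr hg hx)
  have h4 := mul_le_mul_of_nonneg_right (hr.perturbation_le) (sq_nonneg ‖a‖)
  have h5 := mul_nonneg hr.μ_pos.le (sq_nonneg ‖a‖)
  linarith

theorem NearInit.norm_feat_lower (hr : Regime n m α τ ρ θ μ R) (hg : GoodInit α τ ρ θ μ U x y b₀ c)
    (hw : NearInit α R b₀ w)
    (hx : ∀ i, ‖x i‖ ≤ 1) (a : EuclideanSpace ℝ (Fin n)) :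
    5 / 8 * μ * ‖a‖ ^ 2 ≤ ‖∑ i, a i • feat x w i‖ ^ 2 := by
  rw [norm_sum_feat_sq]
  linarith [hw.featG_lower hr hg hx a, sq_nonneg ‖∑ i, a i • featV x w i‖]

/-- The features of the directions for balanced lengths `g_k = ‖b_k‖ / α`. -/
def balancedFeatV (α : ℝ) (x : Fin n → EuclideanSpace ℝ (Fin d))
    (b : Fin m → EuclideanSpace ℝ (Fin d)) (i : Fin n) :
    PiLp 2 (fun _ : Fin m => EuclideanSpace ℝ (Fin d)) :=
  WithLp.toLp 2 fun k => (1 / √(m : ℝ) * (1 / α * act (b k) (x i))) • orthPart (b k) (x i)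

/-- Block `k` of the sum is `α g_k/‖b_k‖ ∈ [0, 2]` times the balanced block. This scalar does not
depend on `i`, so whole combinations compare blockwise with no loss in `n`. -/
theorem NearInit.norm_featV_le (hr : Regime n m α τ ρ θ μ R) (hg : GoodInit α τ ρ θ μ U x y b₀ c)
    (hw : NearInit α R b₀ w)
    (a : Fin n → ℝ) :
    ‖∑ i, a i • featV x w i‖ ^ 2 ≤ 4 * ‖∑ i, a i • balancedFeatV α x w.b i‖ ^ 2 := by
  rw [PiLp.norm_sq_eq_of_L2, PiLp.norm_sq_eq_of_L2, Finset.mul_sum]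
  refine Finset.sum_le_sum fun k _ => ?_
  have hα := hr.α_pos
  have h1 : (∑ i, a i • featV x w i) k = (α * (w.g k / ‖w.b k‖)) •
      (∑ i, a i • balancedFeatV α x w.b i) k := by
    simp only [WithLp.ofLp_sum, Finset.sum_apply, PiLp.smul_apply, featV, balancedFeatV,
      Finset.smul_sum, smul_smul]
    refine Finset.sum_congr rfl fun i _ => ?_
    congr 1
    field_simp
  rw [h1, norm_smul, mul_pow, Real.norm_eq_abs, sq_abs]
  gcongr
  have h2 := hw.ratio_le hr hg k
  have h3 : 0 ≤ w.g k / ‖w.b k‖ := div_nonneg (hw.g_nonneg hr hg k) (norm_nonneg _)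
  have h4 : α * (w.g k / ‖w.b k‖) ≤ 2 := by
    rw [le_div_iff₀ hα] at h2
    linarith
  nlinarith [mul_nonneg hα.le h3]

/-- The unstable neurons, a fraction at most `θ`, contribute at most `4/m` each. All others keep
their activation and move only through the Lipschitz dependence of the projection. -/
theorem NearInit.norm_balancedFeatV_sub_sq_le (hr : Regime n m α τ ρ θ μ R)
    (hg : GoodInit α τ ρ θ μ U x y b₀ c)
    (hw : NearInit α R b₀ w)
    (hx : ∀ i, ‖x i‖ ≤ 1) (i : Fin n) :
    ‖balancedFeatV α x w.b i - balancedFeatV α x b₀ i‖ ^ 2 ≤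
      4 * θ + 4 * (4 * (R / (α ^ 2 * τ))) ^ 2 := by
  have hm := hr.m_pos
  have hα := hr.α_pos
  set q := 4 * (R / (α ^ 2 * τ)) with hq
  have h1 : ∀ k, ‖(balancedFeatV α x w.b i - balancedFeatV α x b₀ i) k‖ ^ 2 ≤
      1 / (m : ℝ) * ((if k ∈ unstable α ρ x b₀ i then 4 else 0) + 4 * q ^ 2) := fun k => by
    have hid : (balancedFeatV α x w.b i - balancedFeatV α x b₀ i) k = (1 / √(m : ℝ) * (1 / α)) •
        (act (w.b k) (x i) • orthPart (w.b k) (x i) - act (b₀ k) (x i) • orthPart (b₀ k) (x i)) := by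
      simp only [balancedFeatV, PiLp.sub_apply, smul_sub, smul_smul, mul_assoc]
    have hα1 : (1 / α) ^ 2 ≤ 1 := by
      rw [one_div]
      exact pow_le_one₀ (by positivity) (inv_le_one_of_one_le₀ hr.one_le_α)
    rw [hid, norm_smul, mul_pow, Real.norm_eq_abs, sq_abs, mul_pow, sq (1 / √(m : ℝ)),
      one_div_sqrt_mul_self, mul_assoc]
    gcongr
    refine (mul_le_of_le_one_left (sq_nonneg _) hα1).trans ?_
    split_ifs with hk
    · have h2 : ‖act (w.b k) (x i) • orthPart (w.b k) (x i) -
          act (b₀ k) (x i) • orthPart (b₀ k) (x i)‖ ≤ 1 * 1 + 1 * 1 := by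
        refine (norm_sub_le _ _).trans ?_
        rw [norm_smul, norm_smul, Real.norm_of_nonneg (act_nonneg _ _),
          Real.norm_of_nonneg (act_nonneg _ _)]
        gcongr
        · exact act_le_one _ _
        · exact (norm_orthPart_le _ _).trans (hx i)
        · exact act_le_one _ _
        · exact (norm_orthPart_le _ _).trans (hx i)
      nlinarith [norm_nonneg (act (w.b k) (x i) • orthPart (w.b k) (x i) -
          act (b₀ k) (x i) • orthPart (b₀ k) (x i)), sq_nonneg q]
    · rw [hw.act_eq hr hk, ← smul_sub, norm_smul, Real.norm_of_nonneg (act_nonneg _ _), zero_add]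
      have h2 : act (b₀ k) (x i) * ‖orthPart (w.b k) (x i) - orthPart (b₀ k) (x i)‖ ≤
          1 * (2 * q) := by
        gcongr
        · exact act_le_one _ _
        · refine (norm_orthPart_sub_le (hw.ne_zero hr hg k) (hg.ne_zero hr k) (hx i)).trans ?_
          gcongr
          exact hw.rel_close hr hg k
      calc _ ≤ (1 * (2 * q)) ^ 2 :=
            pow_le_pow_left₀ (mul_nonneg (act_nonneg _ _) (norm_nonneg _)) h2 2
        _ = _ := by ring
  rw [PiLp.norm_sq_eq_of_L2]
  refine (Finset.sum_le_sum fun k _ => h1 k).trans ?_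
  rw [← Finset.mul_sum, Finset.sum_add_distrib, Finset.sum_ite_mem, Finset.univ_inter,
    Finset.sum_const, Finset.sum_const, Finset.card_univ, Fintype.card_fin, nsmul_eq_mul,
    nsmul_eq_mul, one_div, inv_mul_le_iff₀ hm]
  linarith [hg.count i]

/-- Near initialization the evolution matrix is bounded by that at initialization. -/
theorem NearInit.norm_feat_upper (hr : Regime n m α τ ρ θ μ R) (hg : GoodInit α τ ρ θ μ U x y b₀ c)
    (hw : NearInit α R b₀ w)
    (hx : ∀ i, ‖x i‖ ≤ 1) (a : EuclideanSpace ℝ (Fin n)) :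
    ‖∑ i, a i • feat x w i‖ ^ 2 ≤
      10 * spectralNorm (evolution α x c (initParams α b₀)) * ‖a‖ ^ 2 := by
  have hα := hr.α_pos
  have h0 : ‖∑ i, a i • feat x (initParams α b₀) i‖ ^ 2 ≤
      spectralNorm (evolution α x c (initParams α b₀)) * ‖a‖ ^ 2 := by
    rw [norm_sum_smul_sq_eq]
    simp only [← evolution_apply x (initParams α b₀) hα.ne' hg.sign_sq]
    exact sum_le_spectralNorm _ a
  -- The perturbations are small multiples of `μ‖a‖²`. This lower bound at initialization absorbs
  -- them into the spectral norm, which raises the factor from 8 to 10.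
  have hlow := (nearInit_initParams (b₀ := b₀) hα hr.R_nonneg).norm_feat_lower hr hg hx a
  have hbal : ∀ i, featV x (initParams α b₀) i = balancedFeatV α x b₀ i := fun i => by
    simp only [featV, balancedFeatV, initParams]
    congr 1
    ext1 k
    congr 3
    have := hg.norm_pos hr k
    field_simp
  have h1 := hw.norm_featV_le hr hg (x := x) (a := a)
  have h2 := norm_sq_le_two_mul_add (∑ i, a i • balancedFeatV α x w.b i)
    (∑ i, a i • balancedFeatV α x b₀ i)
  have h3 := norm_sum_smul_sub_sq_le a _ _ (hw.norm_balancedFeatV_sub_sq_le hr hg hx)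
  have h4 := norm_sq_le_two_mul_add (∑ i, a i • featG x w i)
    (∑ i, a i • featG x (initParams α b₀) i)
  have h5 := norm_sum_smul_sub_sq_le a _ _ (hw.norm_featG_sub_sq_le hr hg hx)
  have h6 := mul_le_mul_of_nonneg_right (hr.perturbation_le) (sq_nonneg ‖a‖)
  have h7 := mul_le_mul_of_nonneg_right hr.θ_le (sq_nonneg ‖a‖)
  have h8 := mul_nonneg hr.μ_pos.le (sq_nonneg ‖a‖)
  rw [norm_sum_feat_sq] at h0 hlow ⊢
  simp only [← hbal] at h2 h3
  have h9 : n * (4 * θ + 4 * (4 * (R / (α ^ 2 * τ))) ^ 2) * ‖a‖ ^ 2 =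
      4 * (n * θ * ‖a‖ ^ 2) + 4 * (n * (4 * (R / (α ^ 2 * τ))) ^ 2 * ‖a‖ ^ 2) := by ring
  have h10 := sq_nonneg ‖∑ i, a i • featG x (initParams α b₀) i‖
  linarith

end Descent

/-! ### One-step contraction and linear convergence -/

section Convergence

variable {n d m : ℕ} {α τ ρ θ μ U R D η : ℝ} {x : Fin n → EuclideanSpace ℝ (Fin d)}
  {y : EuclideanSpace ℝ (Fin n)} {b₀ : Fin m → EuclideanSpace ℝ (Fin d)} {c : Fin m → ℝ}
  {w : Params d m}

theorem network_eq {w : Params d m} (hg : ∀ k, 0 ≤ w.g k) (z : EuclideanSpace ℝ (Fin d)) :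
    network c w z =
      1 / √(m : ℝ) * ∑ k, c k * (w.g k * (relu (inner ℝ (w.b k) z) / ‖w.b k‖)) := by
  unfold network
  congr 1
  refine Finset.sum_congr rfl fun k _ => ?_
  rw [relu_mul (hg k), div_eq_mul_inv, mul_comm _ (‖w.b k‖⁻¹), relu_mul (by positivity)]
  ring

/-- Tested on a basis vector. It turns the step-size condition into `ημ ≤ 2/25`. -/
theorem feat_le_spectralNorm (hr : Regime n m α τ ρ θ μ R) (hg : GoodInit α τ ρ θ μ U x y b₀ c)
    (hx : ∀ i, ‖x i‖ ≤ 1) :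
    5 / 8 * μ ≤ spectralNorm (evolution α x c (initParams α b₀)) := by
  have hα := hr.α_pos
  set a : EuclideanSpace ℝ (Fin n) := EuclideanSpace.single ⟨0, hr.one_le_n⟩ (1 : ℝ)
  have ha : ‖a‖ = 1 := by simp [a]
  have h1 := (nearInit_initParams (b₀ := b₀) hα hr.R_nonneg).norm_feat_lower hr hg hx a
  have h2 := sum_le_spectralNorm (evolution α x c (initParams α b₀)) a
  simp only [evolution_apply x (initParams α b₀) hα.ne' hg.sign_sq] at h2
  rw [← norm_sum_smul_sq_eq, ha] at h2
  rw [ha] at h1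
  linarith

/-- The direction gradient carries the additional factor `g_k/‖b_k‖ ≤ 2/α`, which is why `NearInit`
allows directions `2/α` times the displacement of lengths. The norm condition survives by
orthogonality of the gradient. -/
theorem NearInit.gdStep (hr : Regime n m α τ ρ θ μ R) (hg : GoodInit α τ ρ θ μ U x y b₀ c)
    (hx : ∀ i, ‖x i‖ ≤ 1) (hη : 0 < η) (hw : NearInit α D b₀ w)
    (hD : D + η * (√n * ‖predictions x c w - y‖ / √m) ≤ R) :
    NearInit α (D + η * (√n * ‖predictions x c w - y‖ / √m)) b₀ (gdStep η x y c w) ∧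
    (∀ k, |(WeightNorm.gdStep η x y c w).g k - w.g k| ≤
      η * (√n * ‖predictions x c w - y‖ / √m)) ∧
    (∀ k, ‖(WeightNorm.gdStep η x y c w).b k - w.b k‖ ≤
      2 / α * (η * (√n * ‖predictions x c w - y‖ / √m))) := by
  have hα := hr.α_pos
  have hwR : NearInit α R b₀ w := hw.mono hα ((le_add_of_nonneg_right (by positivity)).trans hD)
  have h1 : ∀ k, |(WeightNorm.gdStep η x y c w).g k - w.g k| ≤
      η * (√n * ‖predictions x c w - y‖ / √m) := fun k => by
    simp only [WeightNorm.gdStep, sub_sub_cancel_left, abs_neg]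
    rw [abs_mul, abs_of_pos hη]
    gcongr
    exact abs_gradG_le x w y c hx hg.sign k
  have h2 : ∀ k, ‖(WeightNorm.gdStep η x y c w).b k - w.b k‖ ≤
      2 / α * (η * (√n * ‖predictions x c w - y‖ / √m)) := fun k => by
    simp only [WeightNorm.gdStep, sub_sub_cancel_left, norm_neg]
    rw [norm_smul, Real.norm_of_nonneg hη.le, mul_left_comm]
    gcongr
    exact norm_gradB_le x w y c hx hg.sign k (hwR.g_nonneg hr hg k) (hwR.ratio_le hr hg k)
  refine ⟨⟨fun k => ?_, fun k => ?_, fun k => ?_⟩, h1, h2⟩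
  · have := abs_sub_le ((WeightNorm.gdStep η x y c w).g k) (w.g k) (‖b₀ k‖ / α)
    linarith [h1 k, hw.g_close k]
  · have h3 := norm_sub_le_norm_sub_add_norm_sub ((WeightNorm.gdStep η x y c w).b k) (w.b k) (b₀ k)
    have h4 : 2 * (D + η * (√n * ‖predictions x c w - y‖ / √m)) / α =
      2 * D / α + 2 / α * (η * (√n * ‖predictions x c w - y‖ / √m)) := by ring
    linarith [h2 k, hw.b_close k]
  · refine (hw.norm_le k).trans ?_
    have h3 := norm_sub_sq_real (w.b k) (η • gradB x y c w k)
    rw [inner_smul_right, inner_gradB_self, mul_zero, mul_zero, sub_zero] at h3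
    refine le_of_pow_le_pow_left₀ two_ne_zero (norm_nonneg _) ?_
    simp only [WeightNorm.gdStep]
    rw [h3]
    linarith [sq_nonneg ‖η • gradB x y c w k‖]

/-- Deviation of one gradient step from its linearization. -/
theorem norm_linearization_error_le (hr : Regime n m α τ ρ θ μ R)
    (hg : GoodInit α τ ρ θ μ U x y b₀ c) (hx : ∀ i, ‖x i‖ ≤ 1) (hη : 0 < η)
    (hw : NearInit α D b₀ w) (hD0 : 0 ≤ D)
    (hD : D + η * (√n * ‖predictions x c w - y‖ / √m) ≤ R) (i : Fin n) :
    |network c (gdStep η x y c w) (x i) - network c w (x i) -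
        -η * ∑ j, inner ℝ (feat x w i) (feat x w j) * (predictions x c w - y) j| ≤
      √m * ((4 * θ + 14 * (R / (α ^ 2 * τ))) *
        (η * (√n * ‖predictions x c w - y‖ / √m))) := by
  have hα := hr.α_pos
  have hm := hr.m_pos
  have hτ := hr.τ_pos
  obtain ⟨hw', hΔg, hΔb⟩ := hw.gdStep hr hg hx hη hD
  rw [← linear_part_gdStep x w y c hg.sign_sq]
  have hh0 : 0 ≤ η * (√n * ‖predictions x c w - y‖ / √m) := by positivity
  set h := η * (√n * ‖predictions x c w - y‖ / √m) with hh
  have hhR : h ≤ R := by linarith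
  replace hw' := hw'.mono hα hD
  have hwR : NearInit α R b₀ w := hw.mono hα (by linarith)
  rw [network_eq (hw'.g_nonneg hr hg), network_eq (hwR.g_nonneg hr hg), ← mul_sub, ← mul_sub,
    abs_mul, abs_of_nonneg (by positivity : 0 ≤ 1 / √(m : ℝ)), ← Finset.sum_sub_distrib,
    ← Finset.sum_sub_distrib]
  set w' := WeightNorm.gdStep η x y c w with hwdef
  have hterm : ∀ k, |c k * (w'.g k * (relu (inner ℝ (w'.b k) (x i)) / ‖w'.b k‖)) -
      c k * (w.g k * (relu (inner ℝ (w.b k) (x i)) / ‖w.b k‖)) -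
      c k * ((w'.g k - w.g k) * (relu (inner ℝ (w.b k) (x i)) / ‖w.b k‖) +
        w.g k / ‖w.b k‖ * (act (w.b k) (x i) * inner ℝ (w'.b k - w.b k) (x i)))| ≤
      (if k ∈ unstable α ρ x b₀ i then 4 * h else 0) + 14 * (R / (α ^ 2 * τ)) * h := fun k => by
    rw [← mul_sub, ← mul_sub, abs_mul, hg.sign, one_mul]
    have horth : inner ℝ (w.b k) (w'.b k - w.b k) = 0 := by
      simp [hwdef, WeightNorm.gdStep, inner_smul_right, inner_gradB_self]
    refine (abs_neuron_sub_le (hwR.ne_zero hr hg k) (hx i) horth (hw'.g_nonneg hr hg k)).trans ?_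
    have hp := hw'.ratio_le hr hg k
    have hp0 : 0 ≤ w'.g k / ‖w'.b k‖ := div_nonneg (hw'.g_nonneg hr hg k) (norm_nonneg _)
    have hN : α * τ ≤ ‖w.b k‖ := (hg.norm_ge k).trans (hwR.norm_le k)
    have hα1 : 1 / α ≤ 1 := by rw [one_div]; exact inv_le_one_of_one_le₀ hr.one_le_α
    gcongr ?_ + ?_
    -- Unstable neurons cost first order in the step `h`; for stable ones the ReLU remainder
    -- vanishes exactly.
    · split_ifs with hk
      · calc _ ≤ 2 / α * (2 / α * h) := by
              gcongr
              exact (abs_relu_inner_sub_le _ _ (hx i)).trans (hΔb k)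
          _ = 4 * ((1 / α) ^ 2 * h) := by ring
          _ ≤ 4 * h := by
              gcongr
              exact mul_le_of_le_one_left hh0 (pow_le_one₀ (by positivity) hα1)
      · rw [relu_inner_sub_eq ((hw'.act_eq hr hk).trans (hwR.act_eq hr hk).symm), abs_zero,
          mul_zero]
    -- Terms quadratic in `h`: one factor `h` is traded for the total budget `R`, so the error stays
    -- proportional to the residual.
    · calc _ ≤ h * (2 / α * h) / (α * τ) + 3 / 2 * (2 / α * (2 / α * h) ^ 2 / (α * τ)) := by
            gcongr
            · exact hΔg k
            · exact hΔb k
            · exact hΔb k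
        _ = (2 + 12 * (1 / α) ^ 2) * (h / (α ^ 2 * τ)) * h := by field_simp; ring
        _ ≤ (2 + 12 * 1) * (R / (α ^ 2 * τ)) * h := by
            gcongr
            exact pow_le_one₀ (by positivity) hα1
        _ = _ := by ring
  have hsum := (Finset.abs_sum_le_sum_abs _ _).trans
    (Finset.sum_le_sum fun k (_ : k ∈ Finset.univ) => hterm k)
  rw [Finset.sum_add_distrib, Finset.sum_ite_mem, Finset.univ_inter, Finset.sum_const,
    Finset.sum_const, Finset.card_univ, Fintype.card_fin, nsmul_eq_mul, nsmul_eq_mul] at hsum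
  have hcount : ((unstable α ρ x b₀ i).card : ℝ) * (4 * h) ≤ θ * m * (4 * h) := by
    gcongr
    exact hg.count i
  calc _ ≤ 1 / √(m : ℝ) * (θ * m * (4 * h) + m * (14 * (R / (α ^ 2 * τ)) * h)) := by
        gcongr
        linarith
    _ = m / √(m : ℝ) * ((4 * θ + 14 * (R / (α ^ 2 * τ))) * h) := by ring
    _ = _ := by rw [Real.div_sqrt]

/-- The linearized step gains `15/32 ημ`, the square-root form of `3/2 · 5/8`, and the linearization
error costs at most `1/8 ημ`. The remaining `11/32` exceeds `1/3`. -/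
theorem norm_residual_gdStep_le (hr : Regime n m α τ ρ θ μ R)
    (hg : GoodInit α τ ρ θ μ U x y b₀ c) (hx : ∀ i, ‖x i‖ ≤ 1) (hη : 0 < η)
    (hηΛ : η * spectralNorm (evolution α x c (initParams α b₀)) ≤ 1 / 20)
    (hw : NearInit α D b₀ w) (hD0 : 0 ≤ D)
    (hD : D + η * (√n * ‖predictions x c w - y‖ / √m) ≤ R) :
    ‖predictions x c (gdStep η x y c w) - y‖ ≤
      (1 - η * μ / 3) * ‖predictions x c w - y‖ := by
  have hα := hr.α_pos
  have hm := hr.m_pos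
  have hμ := hr.μ_pos
  have hwR : NearInit α R b₀ w := hw.mono hα ((le_add_of_nonneg_right (by positivity)).trans hD)
  have herr := norm_linearization_error_le hr hg hx hη hw hD0 hD
  set u := predictions x c w - y with hu
  have hημ : η * μ ≤ 2 / 25 := by
    have := mul_le_mul_of_nonneg_left (feat_le_spectralNorm hr hg hx) hη.le
    linarith
  have hημ0 : 0 < η * μ := mul_pos hη hμ
  have hmain := norm_sub_gram_sq_le (feat x w) u hη.le (hwR.norm_feat_upper hr hg hx)
    (hwR.norm_feat_lower hr hg hx u) (by linarith)
  set v : EuclideanSpace ℝ (Fin n) :=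
    u - η • WithLp.toLp 2 (fun i => ∑ j, inner ℝ (feat x w i) (feat x w j) * u j) with hv
  have hv1 : ‖v‖ ≤ (1 - 15 / 32 * (η * μ)) * ‖u‖ := by
    refine le_of_pow_le_pow_left₀ two_ne_zero (mul_nonneg (by linarith) (norm_nonneg _)) ?_
    refine hmain.trans ?_
    rw [mul_pow]
    gcongr
    nlinarith [sq_nonneg (η * μ)]
  have hB0 : 0 ≤ √m * ((4 * θ + 14 * (R / (α ^ 2 * τ))) * (η * (√n * ‖u‖ / √m))) :=
    (abs_nonneg _).trans (herr ⟨0, hr.one_le_n⟩)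
  have hE : ‖predictions x c (gdStep η x y c w) - y - v‖ ≤
      √n * (√m * ((4 * θ + 14 * (R / (α ^ 2 * τ))) * (η * (√n * ‖u‖ / √m)))) := by
    refine norm_le_sqrt_mul hB0 fun i => ?_
    refine le_trans (le_of_eq ?_) (herr i)
    congr 1
    simp only [hv, hu, predictions, PiLp.sub_apply, PiLp.smul_apply, smul_eq_mul]
    ring
  have hE2 : √n * (√m * ((4 * θ + 14 * (R / (α ^ 2 * τ))) * (η * (√n * ‖u‖ / √m)))) ≤
      1 / 8 * (η * μ) * ‖u‖ := by
    have hsm : √(m : ℝ) ≠ 0 := (Real.sqrt_pos.2 hm).ne'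
    have : √n * (√m * ((4 * θ + 14 * (R / (α ^ 2 * τ))) * (η * (√n * ‖u‖ / √m)))) =
        √n * √n * (4 * θ + 14 * (R / (α ^ 2 * τ))) * (η * ‖u‖) := by
      field_simp
    rw [this, Real.mul_self_sqrt (Nat.cast_nonneg n)]
    calc _ ≤ 1 / 8 * μ * (η * ‖u‖) := by
          refine mul_le_mul_of_nonneg_right ?_ (by positivity)
          linarith [hr.θ_le, hr.R_le_mul]
      _ = _ := by ring
  have htri : ‖predictions x c (gdStep η x y c w) - y‖ ≤
      ‖v‖ + ‖predictions x c (gdStep η x y c w) - y - v‖ := norm_le_norm_add_norm_sub' _ _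
  have : 0 ≤ η * μ * ‖u‖ := by positivity
  linarith

/-- Gradient descent from a good initialization converges linearly and stays close to it. -/
theorem GoodInit.converges (hg : GoodInit α τ ρ θ μ U x y b₀ c)
    (hr : Regime n m α τ ρ θ μ (3 * √n / (√m * μ) * U)) (hx : ∀ i, ‖x i‖ ≤ 1) (hη : 0 < η)
    (hηΛ : η * spectralNorm (evolution α x c (initParams α b₀)) ≤ 1 / 20) (s : ℕ) :
    μ / 2 ≤ leastEigenvalue (evolution α x c (iter α η x y b₀ c s)) ∧
      ‖predictions x c (iter α η x y b₀ c s) - y‖ ^ 2 ≤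
        (1 - η * μ / 2) ^ s * ‖predictions x c (iter α η x y b₀ c 0) - y‖ ^ 2 := by
  have hα := hr.α_pos
  have hμ := hr.μ_pos
  have hm := hr.m_pos
  have hημ : η * μ ≤ 2 / 25 := by
    have := mul_le_mul_of_nonneg_left (feat_le_spectralNorm hr hg hx) hη.le
    linarith
  have hημ0 : 0 < η * μ := mul_pos hη hμ
  -- `D` is the distance budget spent so far. The potential `D + 3√n/(√m μ)‖u‖` does not increase,
  -- which replaces summing a geometric series.
  have hinv : ∃ D, 0 ≤ D ∧ NearInit α D b₀ (iter α η x y b₀ c s) ∧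
      D + 3 * √n / (√m * μ) * ‖predictions x c (iter α η x y b₀ c s) - y‖ ≤
        3 * √n / (√m * μ) * U ∧
      ‖predictions x c (iter α η x y b₀ c s) - y‖ ^ 2 ≤
        (1 - η * μ / 2) ^ s * ‖predictions x c (iter α η x y b₀ c 0) - y‖ ^ 2 := by
    induction s with
    | zero =>
      refine ⟨0, le_rfl, nearInit_initParams hα le_rfl, ?_, by simp⟩
      rw [zero_add]
      gcongr
      exact hg.loss
    | succ s ih =>
      obtain ⟨D, hD0, hw, hDR, hloss⟩ := ih
      have hiter : iter α η x y b₀ c (s + 1) = gdStep η x y c (iter α η x y b₀ c s) := by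
        simp only [iter, Function.iterate_succ_apply']
      set w := iter α η x y b₀ c s
      set u := predictions x c w - y
      -- The movement in one step is exactly the fraction `ημ/3` of the potential's second term,
      -- which is what the contraction of `‖u‖` releases.
      have hstep : η * (√n * ‖u‖ / √m) = η * μ / 3 * (3 * √n / (√m * μ) * ‖u‖) := by
        field_simp
      have hB : 0 ≤ 3 * √n / (√m * μ) := by positivity
      have hB' : 0 ≤ 3 * √n / (√m * μ) * ‖u‖ := by positivity
      have hD : D + η * (√n * ‖u‖ / √m) ≤ 3 * √n / (√m * μ) * U := by
        rw [hstep]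
        nlinarith
      have hres := norm_residual_gdStep_le hr hg hx hη hηΛ hw hD0 hD
      rw [hiter]
      refine ⟨D + η * (√n * ‖u‖ / √m), by positivity, (hw.gdStep hr hg hx hη hD).1, ?_, ?_⟩
      · have := mul_le_mul_of_nonneg_left hres hB
        rw [hstep]
        linarith
      · calc _ ≤ ((1 - η * μ / 3) * ‖u‖) ^ 2 := by gcongr
          _ = (1 - η * μ / 3) ^ 2 * ‖u‖ ^ 2 := by ring
          _ ≤ (1 - η * μ / 2) * ‖u‖ ^ 2 := by
              gcongr
              nlinarith
          _ ≤ (1 - η * μ / 2) * ((1 - η * μ / 2) ^ s *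
                ‖predictions x c (iter α η x y b₀ c 0) - y‖ ^ 2) := by
              gcongr
              linarith
          _ = _ := by ring
  obtain ⟨D, hD0, hw, hDR, hloss⟩ := hinv
  refine ⟨le_leastEigenvalue hr.one_le_n (isHermitian_evolution x _ hα.ne' hg.sign_sq) fun a => ?_,
    hloss⟩
  have hwR := hw.mono hα ((le_add_of_nonneg_right (by positivity)).trans hDR)
  have h1 := hwR.norm_feat_lower hr hg hx a
  simp only [evolution_apply x _ hα.ne' hg.sign_sq]
  rw [← norm_sum_smul_sq_eq]
  have := mul_nonneg hμ.le (sq_nonneg ‖a‖)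
  linarith

end Convergence

/-! ### The law of the initialization: small-ball estimates -/

section Laws

variable {d m : ℕ} {α : ℝ}

instance isProbabilityMeasure_gaussian : IsProbabilityMeasure (gaussian d α) :=
  Measure.isProbabilityMeasure_map (by fun_prop)

instance isProbabilityMeasure_rademacher : IsProbabilityMeasure rademacher where
  measure_univ := by
    simp [rademacher, ENNReal.inv_two_add_inv_two]

instance isProbabilityMeasure_initLaw : IsProbabilityMeasure (initLaw d m α) := by
  unfold initLaw; infer_instance

theorem measurePreserving_initLaw_fst (k : Fin m) :
    MeasurePreserving (fun ω => ω.1 k) (initLaw d m α) (gaussian d α) :=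
  (measurePreserving_eval (fun _ : Fin m => gaussian d α) k).comp measurePreserving_fst

theorem measurePreserving_initLaw_snd (k : Fin m) :
    MeasurePreserving (fun ω => ω.2 k) (initLaw d m α) rademacher :=
  (measurePreserving_eval (fun _ : Fin m => rademacher) k).comp measurePreserving_snd

theorem initLaw_abs_snd_ne_one (k : Fin m) : (initLaw d m α).real {ω | |ω.2 k| ≠ 1} = 0 := by
  have hs : MeasurableSet {t : ℝ | |t| ≠ 1} := by measurability
  have := (measurePreserving_initLaw_snd (d := d) (α := α) k).measureReal_preimage
    hs.nullMeasurableSet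
  refine this.trans ?_
  simp [Measure.real, rademacher, hs]

/-- The density is at most `1/√(2π) ≤ 1/2`, and the interval has length `2ρ`. -/
theorem gaussianReal_abs_le (ρ : ℝ) :
    gaussianReal 0 1 {t | |t| ≤ ρ} ≤ ENNReal.ofReal ρ := by
  have hset : {t : ℝ | |t| ≤ ρ} = Set.Icc (-ρ) ρ := by ext t; simp [abs_le]
  have hpdf : ∀ t, gaussianPDF 0 1 t ≤ ENNReal.ofReal (1 / 2) := fun t => by
    rw [gaussianPDF]
    refine ENNReal.ofReal_le_ofReal ?_
    rw [gaussianPDFReal]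
    have h1 : Real.exp (-(t - 0) ^ 2 / (2 * ((1 : NNReal) : ℝ))) ≤ 1 := by
      rw [Real.exp_le_one_iff]
      have := sq_nonneg (t - 0)
      simp only [NNReal.coe_one]
      linarith
    have h2 : (2 : ℝ) ≤ √(2 * Real.pi * ((1 : NNReal) : ℝ)) := by
      refine Real.le_sqrt_of_sq_le ?_
      simp only [NNReal.coe_one]
      linarith [Real.pi_gt_three]
    have h3 : (√(2 * Real.pi * ((1 : NNReal) : ℝ)))⁻¹ ≤ 1 / 2 := by
      rw [one_div]
      exact inv_anti₀ two_pos h2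
    calc _ ≤ (1 / 2 : ℝ) * 1 := by gcongr
      _ = _ := by ring
  rw [hset, gaussianReal_apply _ one_ne_zero]
  calc ∫⁻ t in Set.Icc (-ρ) ρ, gaussianPDF 0 1 t
      ≤ ∫⁻ _t in Set.Icc (-ρ) ρ, ENNReal.ofReal (1 / 2) := lintegral_mono hpdf
    _ = ENNReal.ofReal ρ := by
      rw [lintegral_const, Measure.restrict_apply_univ, Real.volume_Icc,
        ← ENNReal.ofReal_mul (by norm_num)]
      congr 1
      ring

/-- A small norm forces all `d` independent coordinates to be small. The resulting power `d` is what
allows a union bound over the neurons at the cost of `(m/δ)^(1/d)` only. -/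
theorem gaussian_norm_lt_le (hα : 0 < α) {τ : ℝ} (hτ : 0 ≤ τ) :
    gaussian d α {b | ‖b‖ < α * τ} ≤ ENNReal.ofReal (τ ^ d) := by
  have hs : MeasurableSet {b : EuclideanSpace ℝ (Fin d) | ‖b‖ < α * τ} :=
    measurableSet_lt (by fun_prop) (by fun_prop)
  rw [gaussian, Measure.map_apply (by fun_prop) hs, ← map_pi_eq_stdGaussian,
    Measure.map_apply (by fun_prop) (hs.preimage (by fun_prop))]
  calc _ ≤ Measure.pi (fun _ : Fin d => gaussianReal 0 1)
        (Set.univ.pi fun _ => {t | |t| ≤ τ}) := by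
        refine measure_mono fun v hv i _ => ?_
        simp only [Set.mem_preimage, Set.mem_ofPred_eq, norm_smul, Real.norm_of_nonneg hα.le] at hv
        have h1 := lt_of_mul_lt_mul_left hv hα.le
        have h2 := PiLp.norm_apply_le (WithLp.toLp 2 v : EuclideanSpace ℝ (Fin d)) i
        rw [Real.norm_eq_abs] at h2
        exact h2.trans h1.le
    _ = ∏ _i : Fin d, gaussianReal 0 1 {t | |t| ≤ τ} := Measure.pi_pi _ _
    _ ≤ ∏ _i : Fin d, ENNReal.ofReal τ := Finset.prod_le_prod' fun _ _ => gaussianReal_abs_le τ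
    _ = _ := by simp [ENNReal.ofReal_pow hτ]

theorem initLaw_norm_lt_le (hα : 0 < α) {τ : ℝ} (hτ : 0 ≤ τ) (k : Fin m) :
    (initLaw d m α).real {ω | ‖ω.1 k‖ < α * τ} ≤ τ ^ d := by
  have hs : MeasurableSet {b : EuclideanSpace ℝ (Fin d) | ‖b‖ < α * τ} :=
    measurableSet_lt (by fun_prop) (by fun_prop)
  have := (measurePreserving_initLaw_fst (d := d) (α := α) k).measureReal_preimage
    hs.nullMeasurableSet
  refine this.le.trans ?_
  exact ENNReal.toReal_le_of_le_ofReal (by positivity) (gaussian_norm_lt_le hα hτ)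

theorem map_inner_div_gaussian (hα : α ≠ 0) (x : EuclideanSpace ℝ (Fin d)) :
    (gaussian d α).map (fun b => inner ℝ b x / α) = gaussianReal 0 (‖x‖ ^ 2).toNNReal := by
  rw [gaussian, Measure.map_map (by fun_prop) (by fun_prop)]
  have h1 : (fun b => inner ℝ b x / α) ∘ (fun v : EuclideanSpace ℝ (Fin d) => α • v) =
      innerSL ℝ x := by
    ext v
    rw [Function.comp_apply, inner_smul_left, innerSL_apply_apply, real_inner_comm]
    simp [hα]
  rw [h1, IsGaussian.map_eq_gaussianReal, integral_strongDual_stdGaussian,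
    variance_dual_stdGaussian, innerSL_apply_norm]

theorem gaussian_abs_inner_le (hα : 0 < α) {x : EuclideanSpace ℝ (Fin d)} (hx : x ≠ 0) (ρ : ℝ) :
    gaussian d α {b | |inner ℝ b x| ≤ ρ * (α * ‖x‖)} ≤ ENNReal.ofReal ρ := by
  have hx' : 0 < ‖x‖ := norm_pos_iff.2 hx
  have h1 := map_inner_div_gaussian hα.ne' ((1 / ‖x‖) • x)
  have h2 : ‖(1 / ‖x‖) • x‖ = 1 := by
    rw [norm_smul]
    simp [hx'.ne']
  rw [h2, one_pow, Real.toNNReal_one] at h1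
  refine le_of_eq_of_le ?_ (gaussianReal_abs_le ρ)
  rw [← h1, Measure.map_apply (by fun_prop) (measurableSet_le (by fun_prop) (by fun_prop))]
  congr 1
  ext b
  simp only [Set.mem_ofPred_eq, Set.mem_preimage, inner_smul_right]
  rw [abs_div, abs_mul, abs_of_pos (by positivity : 0 < 1 / ‖x‖), abs_of_pos hα,
    div_le_iff₀ hα, one_div, inv_mul_le_iff₀ hx']
  constructor <;> intro h <;> linarith

end Laws

/-! ### Concentration of sums over neurons -/

section Concentration

variable {d m : ℕ} {α : ℝ}

/-- Regrouping coordinates turns `initLaw` into a product of laws of pairs `(b_k, c_k)`, so the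
summands are independent and the sub-Gaussian Chernoff bound applies. -/
theorem initLaw_sum_ge_le {X : EuclideanSpace ℝ (Fin d) × ℝ → ℝ} {v : NNReal}
    (hX : HasSubgaussianMGF X v ((gaussian d α).prod rademacher)) (hXm : Measurable X) {ε : ℝ}
    (hε : 0 ≤ ε) :
    (initLaw d m α).real {ω | ε ≤ ∑ k, X (ω.1 k, ω.2 k)} ≤
      Real.exp (-ε ^ 2 / (2 * (m * v))) := by
  have hmp := measurePreserving_arrowProdEquivProdArrow (EuclideanSpace ℝ (Fin d)) ℝ (Fin m)
    (fun _ => gaussian d α) (fun _ => rademacher)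
  have hs : MeasurableSet {ω : (Fin m → EuclideanSpace ℝ (Fin d)) × (Fin m → ℝ) |
      ε ≤ ∑ k, X (ω.1 k, ω.2 k)} := measurableSet_le (by fun_prop) (by fun_prop)
  have h1 := hmp.measureReal_preimage hs.nullMeasurableSet
  rw [initLaw, ← h1]
  have hind : iIndepFun (fun (k : Fin m) (ω : Fin m → EuclideanSpace ℝ (Fin d) × ℝ) => X (ω k))
      (Measure.pi fun _ => (gaussian d α).prod rademacher) :=
    iIndepFun_pi (fun _ => hXm.aemeasurable)
  have hsub : ∀ k ∈ (Finset.univ : Finset (Fin m)), HasSubgaussianMGF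
      (fun ω : Fin m → EuclideanSpace ℝ (Fin d) × ℝ => X (ω k)) v
      (Measure.pi fun _ => (gaussian d α).prod rademacher) := fun k _ => by
    refine HasSubgaussianMGF.of_map (Y := fun ω : Fin m → EuclideanSpace ℝ (Fin d) × ℝ => ω k)
      (measurable_pi_apply k).aemeasurable ?_
    rwa [(measurePreserving_eval (fun _ : Fin m => (gaussian d α).prod rademacher) k).map_eq]
  have h2 := HasSubgaussianMGF.measure_sum_ge_le_of_iIndepFun hind (c := fun _ => v) hsub hε
  simp only [Finset.sum_const, Finset.card_univ, Fintype.card_fin, nsmul_eq_mul] at h2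
  exact h2

theorem initLaw_bounded_sum_ge_le {F : EuclideanSpace ℝ (Fin d) → ℝ} (hF : Measurable F)
    {a : ℝ} (h : ∀ b, F b ∈ Set.Icc a (a + 1)) {t : ℝ} (ht : 0 ≤ t) :
    (initLaw d m α).real {ω | m * t ≤ ∑ k, (F (ω.1 k) - ∫ b, F b ∂gaussian d α)} ≤
      Real.exp (-(2 * m * t ^ 2)) := by
  have h1 := hasSubgaussianMGF_of_mem_Icc (μ := gaussian d α) hF.aemeasurable (ae_of_all _ h)
  have h2 : HasSubgaussianMGF (fun p : EuclideanSpace ℝ (Fin d) × ℝ =>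
      F p.1 - ∫ b, F b ∂gaussian d α) ((‖a + 1 - a‖₊ / 2) ^ 2)
      ((gaussian d α).prod rademacher) := by
    refine HasSubgaussianMGF.of_map (X := fun b => F b - ∫ b, F b ∂gaussian d α)
      (Y := (Prod.fst : EuclideanSpace ℝ (Fin d) × ℝ → _)) measurable_fst.aemeasurable ?_
    rwa [Measure.map_fst_prod, measure_univ, one_smul]
  refine (initLaw_sum_ge_le h2 (by fun_prop) (by positivity)).trans (Real.exp_le_exp.2 ?_)
  rw [add_sub_cancel_left]
  rcases Nat.eq_zero_or_pos m with rfl | hm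
  · simp
  · have : (0 : ℝ) < m := by exact_mod_cast hm
    simp
    field_simp
    norm_num

theorem measurable_relu : Measurable relu := by unfold relu; fun_prop

/-- Averaging over the sign symmetrizes the exponential, and `exp(t σ(z)) + exp(-t σ(z)) ≤ exp(tz) +
exp(-tz)`: equality for `z ≥ 0`, and the left side is 2 otherwise. The moment generating function is
thus below that of a Gaussian with variance `‖x‖² ≤ 1`. -/
theorem hasSubgaussianMGF_sign_mul_relu (hα : α ≠ 0) {x : EuclideanSpace ℝ (Fin d)}
    (hx : ‖x‖ ≤ 1) :
    HasSubgaussianMGF (fun p : EuclideanSpace ℝ (Fin d) × ℝ => p.2 * relu (inner ℝ p.1 x / α)) 1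
      ((gaussian d α).prod rademacher) := by
  have hlaw := map_inner_div_gaussian hα x
  have hr := measurable_relu
  have hprod : (gaussian d α).prod rademacher =
      (2⁻¹ : ENNReal) • (gaussian d α).map (fun b => (b, (1 : ℝ))) +
        (2⁻¹ : ENNReal) • (gaussian d α).map (fun b => (b, (-1 : ℝ))) := by
    rw [rademacher, Measure.prod_add, Measure.prod_smul_right, Measure.prod_smul_right,
      Measure.prod_dirac, Measure.prod_dirac]
  have hint : ∀ t : ℝ, Integrable (fun b => Real.exp (t * (inner ℝ b x / α))) (gaussian d α) :=
    fun t => by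
      have := integrable_exp_mul_gaussianReal (μ := 0) (v := (‖x‖ ^ 2).toNNReal) t
      rw [← hlaw, integrable_map_measure (by fun_prop) (by fun_prop)] at this
      exact this
  have hle : ∀ t z : ℝ, Real.exp (t * relu z) + Real.exp (-t * relu z) ≤
      Real.exp (t * z) + Real.exp (-t * z) := fun t z => by
    unfold relu
    rcases le_total 0 z with hz | hz
    · rw [max_eq_left hz]
    · rw [max_eq_right hz]
      have h1 := Real.add_one_le_exp (t * z)
      have h2 := Real.add_one_le_exp (-t * z)
      simp only [mul_zero, Real.exp_zero]
      linarith
  have hm1 : ∀ t : ℝ, Measurable fun b : EuclideanSpace ℝ (Fin d) =>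
      Real.exp (t * relu (inner ℝ b x / α)) := fun t => by fun_prop
  have hintr : ∀ t : ℝ, Integrable (fun b => Real.exp (t * relu (inner ℝ b x / α)))
      (gaussian d α) := fun t => by
    refine ((hint t).add (hint (-t))).mono' (hm1 t).aestronglyMeasurable (ae_of_all _ fun b => ?_)
    rw [Real.norm_of_nonneg (Real.exp_nonneg _)]
    exact (le_add_of_nonneg_right (Real.exp_nonneg _)).trans (hle t _)
  have hf : ∀ t : ℝ, Measurable fun p : EuclideanSpace ℝ (Fin d) × ℝ =>
      Real.exp (t * (p.2 * relu (inner ℝ p.1 x / α))) := fun t => by fun_prop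
  have e1 : ∀ (t : ℝ) (b : EuclideanSpace ℝ (Fin d)), t * (1 * relu (inner ℝ b x / α)) =
    t * relu (inner ℝ b x / α) := fun t b => by ring
  have e2 : ∀ (t : ℝ) (b : EuclideanSpace ℝ (Fin d)), t * (-1 * relu (inner ℝ b x / α)) =
    -t * relu (inner ℝ b x / α) := fun t b => by ring
  have hI : ∀ (s t : ℝ), (∀ b : EuclideanSpace ℝ (Fin d), t * (s * relu (inner ℝ b x / α)) =
      (t * s) * relu (inner ℝ b x / α)) := fun s t b => by ring
  have hi : ∀ (s t : ℝ), Integrable (fun p : EuclideanSpace ℝ (Fin d) × ℝ =>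
      Real.exp (t * (p.2 * relu (inner ℝ p.1 x / α))))
      ((2⁻¹ : ENNReal) • (gaussian d α).map (fun b => (b, s))) := fun s t => by
    refine Integrable.smul_measure ?_ (by simp)
    rw [integrable_map_measure (hf t).aestronglyMeasurable (by fun_prop)]
    refine (hintr (t * s)).congr (ae_of_all _ fun b => ?_)
    simp only [Function.comp_apply, hI]
  refine ⟨fun t => ?_, fun t => ?_⟩
  · rw [hprod]
    exact (hi 1 t).add_measure (hi (-1) t)
  · rw [mgf, hprod, integral_add_measure (hi 1 t) (hi (-1) t), integral_smul_measure,
      integral_smul_measure, integral_map (by fun_prop) (hf t).aestronglyMeasurable,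
      integral_map (by fun_prop) (hf t).aestronglyMeasurable]
    have hmgf : ∀ t : ℝ, ∫ b, Real.exp (t * (inner ℝ b x / α)) ∂gaussian d α =
        Real.exp (‖x‖ ^ 2 * t ^ 2 / 2) := fun t => by
      have := mgf_gaussianReal hlaw t
      rw [mgf] at this
      rw [this]
      congr 1
      rw [Real.coe_toNNReal _ (sq_nonneg _)]
      ring
    simp only [e1, e2, ← smul_add]
    rw [← integral_add (hintr t) (hintr (-t))]
    have h1 : ∫ b, (Real.exp (t * relu (inner ℝ b x / α)) +
        Real.exp (-t * relu (inner ℝ b x / α))) ∂gaussian d α ≤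
        2 * Real.exp (‖x‖ ^ 2 * t ^ 2 / 2) := by
      calc _ ≤ ∫ b, (Real.exp (t * (inner ℝ b x / α)) +
            Real.exp (-t * (inner ℝ b x / α))) ∂gaussian d α :=
            integral_mono ((hintr t).add (hintr (-t))) ((hint t).add (hint (-t)))
              fun b => hle t _
        _ = _ := by
            rw [integral_add (hint t) (hint (-t)), hmgf, hmgf]
            ring_nf
    have h2 : Real.exp (‖x‖ ^ 2 * t ^ 2 / 2) ≤ Real.exp (((1 : NNReal) : ℝ) * t ^ 2 / 2) := by
      have : ‖x‖ ^ 2 ≤ 1 := pow_le_one₀ (norm_nonneg _) hx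
      simp only [NNReal.coe_one]
      gcongr
    refine le_trans ?_ h2
    rw [smul_eq_mul, ENNReal.toReal_inv, ENNReal.toReal_ofNat]
    linarith

end Concentration

/-! ### Positive definiteness of the infinite-width Gram matrix -/

section Positivity

variable {n d : ℕ} {α : ℝ}

/-- All three points lie on the same closed side of the kink, where ReLU is linear. -/
theorem relu_second_difference {s t : ℝ} (h : |s| ≤ |t|) :
    relu (t + s) + relu (t - s) - 2 * relu t = 0 := by
  obtain ⟨h1, h2⟩ := abs_le.1 h
  unfold relu
  rcases abs_cases t with ⟨h3, h4⟩ | ⟨h3, h4⟩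
  · rw [max_eq_left (by linarith), max_eq_left (by linarith), max_eq_left h4]
    ring
  · rw [max_eq_right (by linarith), max_eq_right (by linarith), max_eq_right h4.le]
    ring

/-- Non-parallelism makes each `xⱼ⊥ ∩ xᵢ⊥` a proper subspace of `xᵢ⊥`, and a real vector space is
not a finite union of proper subspaces. -/
theorem exists_orthogonal_inner_ne_zero {x : Fin n → EuclideanSpace ℝ (Fin d)}
    (hx : ∀ i, x i ≠ 0) (hpar : ∀ i j, i ≠ j → ∀ β : ℝ, β ≠ 0 → x i ≠ β • x j) (i : Fin n) :
    ∃ b, inner ℝ b (x i) = 0 ∧ ∀ j, j ≠ i → inner ℝ b (x j) ≠ 0 := by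
  set W : Submodule ℝ (EuclideanSpace ℝ (Fin d)) := (ℝ ∙ x i)ᗮ with hW
  let p : {j // j ≠ i} → Submodule ℝ W := fun j => (ℝ ∙ x j.1)ᗮ.comap W.subtype
  have hp : ∀ j, p j ≠ ⊤ := fun j htop => by
    have h1 : W ≤ (ℝ ∙ x j.1)ᗮ := by
      rw [← Submodule.comap_subtype_eq_top]
      exact htop
    have h2 : (ℝ ∙ x j.1) ≤ ℝ ∙ x i := by
      have := Submodule.orthogonal_le h1
      rwa [Submodule.orthogonal_orthogonal, hW, Submodule.orthogonal_orthogonal] at this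
    obtain ⟨β, hβ⟩ := Submodule.mem_span_singleton.1 (h2 (Submodule.mem_span_singleton_self _))
    have hβ0 : β ≠ 0 := by
      rintro rfl
      exact hx j.1 (by rw [← hβ, zero_smul])
    exact hpar j.1 i j.2 β hβ0 hβ.symm
  obtain ⟨b, hb⟩ := Submodule.exists_forall_notMem_of_forall_ne_top p hp
  refine ⟨b, Submodule.mem_orthogonal_singleton_iff_inner_left.1 b.2, fun j hj h0 => ?_⟩
  exact hb ⟨j, hj⟩ (Submodule.mem_orthogonal_singleton_iff_inner_left.2 h0)

/-- ReLU ridge functions along pairwise non-parallel directions are linearly independent. -/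
theorem eq_zero_of_sum_relu_eq_zero {x : Fin n → EuclideanSpace ℝ (Fin d)}
    (hx : ∀ i, x i ≠ 0) (hpar : ∀ i j, i ≠ j → ∀ β : ℝ, β ≠ 0 → x i ≠ β • x j) {a : Fin n → ℝ}
    (h : ∀ b, ∑ i, a i * relu (inner ℝ b (x i)) = 0) (i : Fin n) : a i = 0 := by
  obtain ⟨b, hbi, hbj⟩ := exists_orthogonal_inner_ne_zero hx hpar i
  -- Take a second difference at `b` along `ε xᵢ`. For small `ε` only the `i`-th ridge has a kink in
  -- the segment, so all other terms cancel and `aᵢ ε‖xᵢ‖² = 0` remains.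
  have hev : ∀ j, ∀ᶠ ε : ℝ in nhdsWithin 0 (Set.Ioi 0),
      j ≠ i → |inner ℝ (ε • x i) (x j)| ≤ |inner ℝ b (x j)| := fun j => by
    rcases eq_or_ne j i with hj | hj
    · exact Filter.Eventually.of_forall fun _ h => (h hj).elim
    · have hc : Continuous fun ε : ℝ => |inner ℝ (ε • x i) (x j)| := by fun_prop
      have h1 : ∀ᶠ ε : ℝ in nhds 0, |inner ℝ (ε • x i) (x j)| < |inner ℝ b (x j)| := by
        refine hc.continuousAt.eventually_lt continuousAt_const ?_
        simpa using hbj j hj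
      exact (h1.filter_mono nhdsWithin_le_nhds).mono fun ε hε _ => hε.le
  obtain ⟨ε, hε, hε0⟩ := ((Filter.eventually_all.2 hev).and self_mem_nhdsWithin).exists
  have h1 := h (b + ε • x i)
  have h2 := h (b - ε • x i)
  have h3 := h b
  have hsum : ∑ j, a j * (relu (inner ℝ (b + ε • x i) (x j)) +
      relu (inner ℝ (b - ε • x i) (x j)) - 2 * relu (inner ℝ b (x j))) = 0 := by
    simp only [mul_sub, mul_add, Finset.sum_sub_distrib, Finset.sum_add_distrib,
      mul_left_comm _ (2 : ℝ), ← Finset.mul_sum, h1, h2, h3]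
    simp
  rw [Finset.sum_eq_single i] at hsum
  · have hpos : 0 < ε * ‖x i‖ ^ 2 := mul_pos hε0 (by have := norm_pos_iff.2 (hx i); positivity)
    rw [inner_add_left, inner_sub_left, hbi, real_inner_smul_left, real_inner_self_eq_norm_sq,
      zero_add, zero_sub] at hsum
    unfold relu at hsum
    rw [max_eq_left hpos.le, max_eq_right (by linarith), max_self] at hsum
    simpa [hpos.ne', hx i, (show ε ≠ 0 from (ne_of_gt hε0))] using hsum
  · intro j _ hj
    rw [inner_add_left, inner_sub_left, relu_second_difference (hε j hj), mul_zero]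
  · simp

theorem isOpenPosMeasure_gaussian (hα : α ≠ 0) : (gaussian d α).IsOpenPosMeasure := by
  have h1 : (gaussianReal 0 1).IsOpenPosMeasure :=
    (gaussianReal_absolutelyContinuous' 0 one_ne_zero).isOpenPosMeasure
  rw [gaussian, ← map_pi_eq_stdGaussian, Measure.map_map (by fun_prop) (by fun_prop)]
  refine Continuous.isOpenPosMeasure_map (by fun_prop) fun b => ?_
  refine ⟨WithLp.ofLp (α⁻¹ • b), ?_⟩
  simp [smul_smul, hα]

/-- The contribution of a neuron with direction `b` to the aligned Gram matrix. -/
def alignedKernel (x z b : EuclideanSpace ℝ (Fin d)) : ℝ :=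
  relu (inner ℝ b x) * relu (inner ℝ b z) / ‖b‖ ^ 2

theorem measurable_alignedKernel (x z : EuclideanSpace ℝ (Fin d)) :
    Measurable (alignedKernel x z) := by
  have := measurable_relu
  unfold alignedKernel
  fun_prop

theorem alignedKernel_eq (x z b : EuclideanSpace ℝ (Fin d)) :
    alignedKernel x z b = (relu (inner ℝ b x) / ‖b‖) * (relu (inner ℝ b z) / ‖b‖) := by
  rw [alignedKernel]
  ring

theorem alignedKernel_mem_Icc {x z : EuclideanSpace ℝ (Fin d)} (hx : ‖x‖ ≤ 1) (hz : ‖z‖ ≤ 1)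
    (b : EuclideanSpace ℝ (Fin d)) : alignedKernel x z b ∈ Set.Icc 0 1 := by
  have h1 := relu_div_le_one b hx
  have h2 := relu_div_le_one b hz
  have h3 : 0 ≤ relu (inner ℝ b x) / ‖b‖ := div_nonneg (relu_nonneg _) (norm_nonneg _)
  have h4 : 0 ≤ relu (inner ℝ b z) / ‖b‖ := div_nonneg (relu_nonneg _) (norm_nonneg _)
  rw [alignedKernel_eq]
  exact ⟨mul_nonneg h3 h4, mul_le_one₀ h1 h4 h2⟩

theorem integrable_alignedKernel {x z : EuclideanSpace ℝ (Fin d)} (hx : ‖x‖ ≤ 1) (hz : ‖z‖ ≤ 1) :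
    Integrable (alignedKernel x z) (gaussian d α) :=
  Integrable.of_mem_Icc 0 1 (measurable_alignedKernel x z).aemeasurable
    (ae_of_all _ (alignedKernel_mem_Icc hx hz))

theorem gramGInf_apply (x : Fin n → EuclideanSpace ℝ (Fin d)) (i j : Fin n) :
    gramGInf α x i j = ∫ b, alignedKernel (x i) (x j) b ∂gaussian d α := by
  rw [gramGInf, Matrix.of_apply]
  congr 1
  ext b
  rw [inner_alignedPart_left, alignedKernel, ← act_mul_inner, ← act_mul_inner, alignedPart,
    inner_smul_right, real_inner_self_eq_norm_sq]
  rcases eq_or_ne b 0 with rfl | hb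
  · simp
  · have := norm_pos_iff.2 hb
    field_simp

theorem isHermitian_gramGInf (x : Fin n → EuclideanSpace ℝ (Fin d)) :
    (gramGInf α x).IsHermitian := by
  ext i j
  rw [Matrix.conjTranspose_apply, gramGInf_apply, gramGInf_apply]
  simp [alignedKernel, mul_comm]

theorem sum_gramGInf_eq {x : Fin n → EuclideanSpace ℝ (Fin d)} (hx : ∀ i, ‖x i‖ ≤ 1)
    (a : Fin n → ℝ) :
    ∑ i, ∑ j, a i * gramGInf α x i j * a j =
      ∫ b, (∑ i, a i * (relu (inner ℝ b (x i)) / ‖b‖)) ^ 2 ∂gaussian d α := by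
  have h1 : ∀ b, (∑ i, a i * (relu (inner ℝ b (x i)) / ‖b‖)) ^ 2 =
      ∑ i, ∑ j, a i * alignedKernel (x i) (x j) b * a j := fun b => by
    rw [sq, Finset.sum_mul_sum]
    refine Finset.sum_congr rfl fun i _ => Finset.sum_congr rfl fun j _ => ?_
    rw [alignedKernel_eq]
    ring
  have hint : ∀ i j, Integrable (fun b => a i * alignedKernel (x i) (x j) b * a j)
      (gaussian d α) := fun i j =>
    ((integrable_alignedKernel (hx i) (hx j)).const_mul _).mul_const _
  simp only [h1, gramGInf_apply]
  rw [integral_finsetSum _ fun i _ => integrable_finsetSum _ fun j _ => hint i j]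
  refine Finset.sum_congr rfl fun i _ => ?_
  rw [integral_finsetSum _ fun j _ => hint i j]
  refine Finset.sum_congr rfl fun j _ => ?_
  rw [integral_mul_const, integral_const_mul]

/-- The form is the integral of a square. If it vanishes, the ridge combination vanishes almost
everywhere, hence everywhere by continuity and full support of the Gaussian, and linear independence
applies. -/
theorem sum_gramGInf_pos (hα : α ≠ 0) {x : Fin n → EuclideanSpace ℝ (Fin d)}
    (hx1 : ∀ i, ‖x i‖ ≤ 1) (hx : ∀ i, x i ≠ 0)
    (hpar : ∀ i j, i ≠ j → ∀ β : ℝ, β ≠ 0 → x i ≠ β • x j) {a : Fin n → ℝ} (ha : a ≠ 0) :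
    0 < ∑ i, ∑ j, a i * gramGInf α x i j * a j := by
  rw [sum_gramGInf_eq hx1]
  refine lt_of_le_of_ne (integral_nonneg fun b => sq_nonneg _) fun h0 => ha ?_
  have hrelu := measurable_relu
  have hint : Integrable (fun b => (∑ i, a i * (relu (inner ℝ b (x i)) / ‖b‖)) ^ 2)
      (gaussian d α) := by
    refine Integrable.of_mem_Icc 0 ((∑ i, |a i|) ^ 2) (by fun_prop) (ae_of_all _ fun b => ?_)
    refine ⟨sq_nonneg _, ?_⟩
    rw [← sq_abs]
    refine pow_le_pow_left₀ (abs_nonneg _) ?_ 2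
    refine (Finset.abs_sum_le_sum_abs _ _).trans (Finset.sum_le_sum fun i _ => ?_)
    rw [abs_mul, abs_of_nonneg (div_nonneg (relu_nonneg _) (norm_nonneg b))]
    exact mul_le_of_le_one_right (abs_nonneg _) (relu_div_le_one b (hx1 i))
  have hae := (integral_eq_zero_iff_of_nonneg (fun b => sq_nonneg _) hint).1 h0.symm
  have hopen := isOpenPosMeasure_gaussian (d := d) hα
  -- The factor `1/‖b‖` is removed first, so that continuity also holds at the origin.
  have hcont : Continuous fun b => ∑ i, a i * relu (inner ℝ b (x i)) := by
    unfold relu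
    fun_prop
  have hzero : (fun b => ∑ i, a i * relu (inner ℝ b (x i))) = fun _ => 0 := by
    refine (hcont.ae_eq_iff_eq (gaussian d α) continuous_const).1 ?_
    filter_upwards [hae] with b hb
    rcases eq_or_ne b 0 with rfl | hb0
    · simp [relu]
    · have h2 : ∑ i, a i * (relu (inner ℝ b (x i)) / ‖b‖) =
          (∑ i, a i * relu (inner ℝ b (x i))) / ‖b‖ := by
        rw [Finset.sum_div]
        exact Finset.sum_congr rfl fun i _ => by ring
      have h3 : (∑ i, a i * (relu (inner ℝ b (x i)) / ‖b‖)) = 0 := by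
        simpa using hb
      rw [h2, div_eq_zero_iff] at h3
      exact h3.resolve_right (norm_ne_zero_iff.2 hb0)
  funext i
  exact eq_zero_of_sum_relu_eq_zero hx hpar (fun b => congrFun hzero b) i

theorem leastEigenvalue_pos (hn : 1 ≤ n) {A : Matrix (Fin n) (Fin n) ℝ} (hA : A.IsHermitian)
    (h : ∀ a : Fin n → ℝ, a ≠ 0 → 0 < ∑ i, ∑ j, a i * A i j * a j) : 0 < leastEigenvalue A := by
  have : Nonempty (Fin n) := ⟨⟨0, hn⟩⟩
  have hpd : A.PosDef := by
    refine Matrix.PosDef.of_dotProduct_mulVec_pos hA fun a ha => ?_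
    have := h a ha
    simpa [Matrix.mulVec, dotProduct, Finset.mul_sum, mul_assoc] using this
  unfold leastEigenvalue
  rw [hA.spectrum_real_eq_range_eigenvalues]
  obtain ⟨k, hk⟩ := (Set.range_nonempty hA.eigenvalues).csInf_mem (Set.finite_range _)
  rw [← hk]
  exact hpd.eigenvalues_pos k

theorem leastEigenvalue_gramGInf_pos (hn : 1 ≤ n) (hα : α ≠ 0)
    {x : Fin n → EuclideanSpace ℝ (Fin d)} (hx1 : ∀ i, ‖x i‖ ≤ 1) (hx : ∀ i, x i ≠ 0)
    (hpar : ∀ i j, i ≠ j → ∀ β : ℝ, β ≠ 0 → x i ≠ β • x j) :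
    0 < leastEigenvalue (gramGInf α x) :=
  leastEigenvalue_pos hn (isHermitian_gramGInf x) fun _ ha => sum_gramGInf_pos hα hx1 hx hpar ha

theorem leastEigenvalue_gramGInf_le_one (hn : 1 ≤ n) {x : Fin n → EuclideanSpace ℝ (Fin d)}
    (hx : ∀ i, ‖x i‖ ≤ 1) : leastEigenvalue (gramGInf α x) ≤ 1 := by
  have h1 := leastEigenvalue_mul_le (isHermitian_gramGInf (α := α) x)
    (EuclideanSpace.single ⟨0, hn⟩ (1 : ℝ))
  rw [sum_gramGInf_eq hx] at h1
  have h2 : ∫ b, (∑ i, (EuclideanSpace.single (⟨0, hn⟩ : Fin n) (1 : ℝ)) i *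
      (relu (inner ℝ b (x i)) / ‖b‖)) ^ 2 ∂gaussian d α ≤ ∫ _b, (1 : ℝ) ∂gaussian d α := by
    refine integral_mono_of_nonneg (ae_of_all _ fun b => sq_nonneg _) (integrable_const _)
      (ae_of_all _ fun b => ?_)
    simp only [PiLp.single_apply, ite_mul, one_mul, zero_mul, Finset.sum_ite_eq',
      Finset.mem_univ, if_true]
    exact pow_le_one₀ (div_nonneg (relu_nonneg _) (norm_nonneg _)) (relu_div_le_one b (hx _))
  simp at h1 h2
  linarith

end Positivity

/-! ### A random initialization is good with high probability -/

section GoodEvent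

variable {n d m : ℕ} {α δ K μ M : ℝ} {x : Fin n → EuclideanSpace ℝ (Fin d)}
  {y : EuclideanSpace ℝ (Fin n)}

theorem measureReal_iUnion_le_card_mul {Ω ι : Type*} [MeasurableSpace Ω] [Fintype ι]
    {P : Measure Ω} {s : ι → Set Ω} {p : ℝ} (h : ∀ i, P.real (s i) ≤ p) :
    P.real (⋃ i, s i) ≤ Fintype.card ι * p := by
  refine (measureReal_iUnion_fintype_le _).trans ?_
  refine (Finset.sum_le_sum fun i _ => h i).trans ?_
  simp

/-- Of the five factors `n/δ`, three give `2³ = 8` and the other two dominate `n · (n/δ)`. The bound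
is a failure probability small enough for a union over `n²` pairs at cost `δ/8`. -/
theorem exp_neg_five_mul_log_le (hn : 1 ≤ n) (hδ : 0 < δ) (hδ1 : δ < 1) (h2δ : 2 * δ ≤ n) :
    Real.exp (-(5 * Real.log (n / δ))) ≤ δ / (8 * n ^ 2) := by
  have hn0 : (1 : ℝ) ≤ n := by exact_mod_cast hn
  have hz2 : 2 ≤ (n : ℝ) / δ := by rwa [le_div_iff₀ hδ]
  have hzn : (n : ℝ) ≤ n / δ := by
    rw [le_div_iff₀ hδ]
    nlinarith
  have hz0 : 0 < (n : ℝ) / δ := by linarith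
  have h1 : Real.exp (-(5 * Real.log (n / δ))) = (((n : ℝ) / δ) ^ 5)⁻¹ := by
    rw [Real.exp_neg,
      show (5 : ℝ) * Real.log (n / δ) = ((5 : ℕ) : ℝ) * Real.log (n / δ) by norm_num,
      Real.exp_nat_mul, Real.exp_log hz0]
  have h2 : δ / (8 * n ^ 2) = (8 * n * (n / δ))⁻¹ := by
    rw [← one_div, div_eq_div_iff (by positivity) (by positivity)]
    field_simp
  rw [h1, h2]
  refine inv_anti₀ (by positivity) ?_
  set z := (n : ℝ) / δ
  have h3 : (2 : ℝ) ^ 3 ≤ z ^ 3 := by gcongr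
  calc 8 * n * z ≤ z ^ 3 * z * z := by
        gcongr
        linarith
    _ = z ^ 5 := by ring

/-- `K ^ d` absorbs `m/δ`, and the extra `4` in the threshold supplies the factor `4⁻ᵈ ≤ 1/4`. -/
theorem mul_pow_le_of_rpow_le {d m : ℕ} {δ K : ℝ} (hd : 1 ≤ d) (hδ : 0 < δ) (hK : 1 ≤ K)
    (h : ((m : ℝ) / δ) ^ (1 / (d : ℝ)) ≤ K) : m * (1 / (4 * K)) ^ d ≤ δ / 4 := by
  have hd0 : d ≠ 0 := by omega
  have h1 : (m : ℝ) / δ ≤ K ^ d := by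
    rw [← Real.rpow_inv_natCast_pow (by positivity : 0 ≤ (m : ℝ) / δ) hd0, ← one_div]
    gcongr
  have h2 : ((1 : ℝ) / 4) ^ d ≤ 1 / 4 := pow_le_of_le_one (by norm_num) (by norm_num) hd0
  rw [div_le_iff₀ hδ] at h1
  have h3 : (1 / (4 * K)) ^ d = (1 / 4) ^ d / K ^ d := by
    rw [← div_pow]
    congr 1
    field_simp
  have hKd : 0 < K ^ d := by positivity
  rw [h3]
  calc m * ((1 / 4) ^ d / K ^ d) ≤ K ^ d * δ * (1 / 4 / K ^ d) := by gcongr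
    _ = _ := by field_simp

/-- The balanced lengths cancel the normalization, so the initial network is an ordinary sum of
independent signed ReLU terms. -/
theorem predictions_initParams (hα : 0 < α) (b₀ : Fin m → EuclideanSpace ℝ (Fin d))
    (c : Fin m → ℝ) (i : Fin n) :
    predictions x c (initParams α b₀) i =
      1 / √(m : ℝ) * ∑ k, c k * relu (inner ℝ (b₀ k) (x i) / α) := by
  simp only [predictions, network, initParams]
  congr 1
  refine Finset.sum_congr rfl fun k _ => ?_
  congr 2
  rcases eq_or_ne (b₀ k) 0 with h | h
  · simp [h]
  · have := norm_pos_iff.2 h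
    field_simp

/-- An entrywise error `ε` changes the form by at most `ε(∑|aᵢ|)² ≤ εn‖a‖²`; hence the tolerance
`μ/(8n)`. -/
theorem gramG_lower_of_entries (hn : 1 ≤ n) {A B : Matrix (Fin n) (Fin n) ℝ}
    (hB : ∀ a : EuclideanSpace ℝ (Fin n), μ * ‖a‖ ^ 2 ≤ ∑ i, ∑ j, a i * B i j * a j)
    (h : ∀ i j, |A i j - B i j| ≤ μ / (8 * n)) (a : EuclideanSpace ℝ (Fin n)) :
    7 / 8 * μ * ‖a‖ ^ 2 ≤ ∑ i, ∑ j, a i * A i j * a j := by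
  have hn0 : (0 : ℝ) < n := by exact_mod_cast hn
  have hμ : 0 ≤ μ / (8 * n) := (abs_nonneg _).trans (h ⟨0, hn⟩ ⟨0, hn⟩)
  have h1 : ∑ i, ∑ j, a i * B i j * a j - ∑ i, ∑ j, a i * A i j * a j ≤
      ∑ i, ∑ j, |a i| * (μ / (8 * n)) * |a j| := by
    simp only [← Finset.sum_sub_distrib]
    refine Finset.sum_le_sum fun i _ => Finset.sum_le_sum fun j _ => ?_
    calc a i * B i j * a j - a i * A i j * a j ≤ |a i * (A i j - B i j) * a j| := by
          rw [← abs_neg]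
          refine le_trans (le_of_eq ?_) (le_abs_self _)
          ring
      _ = |a i| * |A i j - B i j| * |a j| := by rw [abs_mul, abs_mul]
      _ ≤ _ := by
          gcongr
          exact h i j
  have h2 : ∑ i, ∑ j, |a i| * (μ / (8 * n)) * |a j| = μ / (8 * n) * (∑ i, |a i|) ^ 2 := by
    rw [sq, Finset.sum_mul_sum, Finset.mul_sum]
    refine Finset.sum_congr rfl fun i _ => ?_
    rw [Finset.mul_sum]
    exact Finset.sum_congr rfl fun j _ => by ring
  have h3 : (∑ i, |a i|) ^ 2 ≤ n * ‖a‖ ^ 2 := by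
    have := pow_le_pow_left₀ (Finset.sum_nonneg fun i _ => abs_nonneg (a i)) (sum_abs_le a) 2
    rwa [mul_pow, Real.sq_sqrt hn0.le] at this
  have h4 : μ / (8 * n) * (∑ i, |a i|) ^ 2 ≤ 1 / 8 * μ * ‖a‖ ^ 2 :=
    calc _ ≤ μ / (8 * n) * (n * ‖a‖ ^ 2) := by gcongr
      _ = _ := by field_simp
  linarith [hB a]

set_option maxHeartbeats 800000 in
/-- With high probability the random initialization is good. -/
theorem exists_goodInit_event (hn : 1 ≤ n) (hd : 1 ≤ d) (hm : 1 ≤ m) (hα : 1 ≤ α) (hδ : 0 < δ)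
    (hδ1 : δ < 1) (h2δ : 2 * δ ≤ n) (hx1 : ∀ i, ‖x i‖ ≤ 1) (hx : ∀ i, x i ≠ 0)
    (hy : ∀ i, |y i| ≤ M) (hK : 1 ≤ K) (hmK : ((m : ℝ) / δ) ^ (1 / (d : ℝ)) ≤ K) (hμ : 0 < μ)
    (hG : ∀ a : EuclideanSpace ℝ (Fin n),
      μ * ‖a‖ ^ 2 ≤ ∑ i, ∑ j, a i * gramGInf α x i j * a j)
    (hwidth : 10000000 * n ^ 2 * Real.log (n / δ) ≤ m * μ ^ 2) :
    ∃ A : Set ((Fin m → EuclideanSpace ℝ (Fin d)) × (Fin m → ℝ)),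
      MeasurableSet A ∧ ENNReal.ofReal (1 - δ) ≤ initLaw d m α A ∧
      ∀ ω ∈ A, GoodInit α (1 / (4 * K)) (μ / (2000 * n)) (μ / (1000 * n)) μ
        (√n * (√(10 * Real.log (n / δ)) + M)) x y ω.1 ω.2 := by
  have hα0 : 0 < α := by linarith
  have hn0 : (1 : ℝ) ≤ n := by exact_mod_cast hn
  have hm0 : (0 : ℝ) < m := by exact_mod_cast hm
  have hM : 0 ≤ M := (abs_nonneg _).trans (hy ⟨0, hn⟩)
  set L := Real.log (n / δ) with hL
  have hL0 : 0 ≤ L := Real.log_nonneg (by rw [le_div_iff₀ hδ]; linarith)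
  have htail := exp_neg_five_mul_log_le hn hδ hδ1 h2δ
  rw [← hL] at htail
  set ρ := μ / (2000 * n) with hρ
  have hρ0 : 0 ≤ ρ := by positivity
  set p := δ / (8 * (n : ℝ) ^ 2) with hp
  have hrelu := measurable_relu
  let F : Fin n → EuclideanSpace ℝ (Fin d) → ℝ := fun i =>
    Set.indicator {b | |inner ℝ b (x i)| ≤ ρ * (α * ‖x i‖)} (fun _ => 1)
  have hFs : ∀ i, MeasurableSet {b : EuclideanSpace ℝ (Fin d) |
      |inner ℝ b (x i)| ≤ ρ * (α * ‖x i‖)} := fun i =>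
    measurableSet_le (by fun_prop) (by fun_prop)
  have hFm : ∀ i, Measurable (F i) := fun i => measurable_const.indicator (hFs i)
  have hKm : ∀ i j, Measurable (alignedKernel (x i) (x j)) := fun i j =>
    measurable_alignedKernel _ _
  let S : Fin n → EuclideanSpace ℝ (Fin d) × ℝ → ℝ := fun i q =>
    q.2 * relu (inner ℝ q.1 (x i) / α)
  have hSm : ∀ i, Measurable (S i) := fun i => by fun_prop
  -- The bad events: a sign other than ±1, a short direction, too many unstable neurons, a Gram
  -- entry too large or too small, an initial output too large or too small.
  let B1 : Fin m → Set ((Fin m → EuclideanSpace ℝ (Fin d)) × (Fin m → ℝ)) := fun k =>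
    {ω | |ω.2 k| ≠ 1}
  let B2 : Fin m → Set ((Fin m → EuclideanSpace ℝ (Fin d)) × (Fin m → ℝ)) := fun k =>
    {ω | ‖ω.1 k‖ < α * (1 / (4 * K))}
  let B3 : Fin n → Set ((Fin m → EuclideanSpace ℝ (Fin d)) × (Fin m → ℝ)) := fun i =>
    {ω | m * ρ ≤ ∑ k, (F i (ω.1 k) - ∫ b, F i b ∂gaussian d α)}
  let B4 : Fin n × Fin n → Set ((Fin m → EuclideanSpace ℝ (Fin d)) × (Fin m → ℝ)) := fun ij =>
    {ω | m * (μ / (8 * n)) ≤ ∑ k, (alignedKernel (x ij.1) (x ij.2) (ω.1 k) -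
      ∫ b, alignedKernel (x ij.1) (x ij.2) b ∂gaussian d α)}
  let B5 : Fin n × Fin n → Set ((Fin m → EuclideanSpace ℝ (Fin d)) × (Fin m → ℝ)) := fun ij =>
    {ω | m * (μ / (8 * n)) ≤ ∑ k, (-alignedKernel (x ij.1) (x ij.2) (ω.1 k) -
      ∫ b, -alignedKernel (x ij.1) (x ij.2) b ∂gaussian d α)}
  let B6 : Fin n → Set ((Fin m → EuclideanSpace ℝ (Fin d)) × (Fin m → ℝ)) := fun i =>
    {ω | √(m * (10 * L)) ≤ ∑ k, S i (ω.1 k, ω.2 k)}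
  let B7 : Fin n → Set ((Fin m → EuclideanSpace ℝ (Fin d)) × (Fin m → ℝ)) := fun i =>
    {ω | √(m * (10 * L)) ≤ ∑ k, -S i (ω.1 k, ω.2 k)}
  have m1 : MeasurableSet (⋃ k, B1 k) := MeasurableSet.iUnion fun k =>
    (measurableSet_eq_fun (by fun_prop) (by fun_prop)).compl
  have m2 : MeasurableSet (⋃ k, B2 k) := MeasurableSet.iUnion fun k =>
    measurableSet_lt (by fun_prop) (by fun_prop)
  have m3 : MeasurableSet (⋃ i, B3 i) := MeasurableSet.iUnion fun i =>
    measurableSet_le (by fun_prop) (by have := hFm i; fun_prop)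
  have m4 : MeasurableSet (⋃ i, B4 i) := MeasurableSet.iUnion fun i =>
    measurableSet_le (by fun_prop) (by have := hKm i.1 i.2; fun_prop)
  have m5 : MeasurableSet (⋃ i, B5 i) := MeasurableSet.iUnion fun i =>
    measurableSet_le (by fun_prop) (by have := hKm i.1 i.2; fun_prop)
  have m6 : MeasurableSet (⋃ i, B6 i) := MeasurableSet.iUnion fun i =>
    measurableSet_le (by fun_prop) (by have := hSm i; fun_prop)
  have m7 : MeasurableSet (⋃ i, B7 i) := MeasurableSet.iUnion fun i =>
    measurableSet_le (by fun_prop) (by have := hSm i; fun_prop)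
  have p1 : (initLaw d m α).real (⋃ k, B1 k) ≤ 0 :=
    (measureReal_iUnion_le_card_mul fun k => (initLaw_abs_snd_ne_one k).le).trans (by simp)
  have p2 : (initLaw d m α).real (⋃ k, B2 k) ≤ δ / 4 := by
    refine (measureReal_iUnion_le_card_mul fun k =>
      initLaw_norm_lt_le hα0 (by positivity) k).trans ?_
    rw [Fintype.card_fin]
    exact mul_pow_le_of_rpow_le hd hδ hK hmK
  -- The most demanding Hoeffding bound: `2mρ² ≥ 5L` with `ρ = μ/(2000n)` is exactly the width
  -- hypothesis with constant `10000000`.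
  have t3 : Real.exp (-(2 * m * ρ ^ 2)) ≤ p := by
    refine (Real.exp_le_exp.2 (neg_le_neg ?_)).trans htail
    have : 2 * m * ρ ^ 2 = m * μ ^ 2 / (2000000 * n ^ 2) := by rw [hρ]; field_simp; norm_num
    rw [this, le_div_iff₀ (by positivity)]
    linarith
  have t4 : Real.exp (-(2 * m * (μ / (8 * n)) ^ 2)) ≤ p := by
    refine (Real.exp_le_exp.2 (neg_le_neg ?_)).trans htail
    have : 2 * m * (μ / (8 * n)) ^ 2 = m * μ ^ 2 / (32 * n ^ 2) := by field_simp; norm_num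
    rw [this, le_div_iff₀ (by positivity)]
    have : 0 ≤ (n : ℝ) ^ 2 * L := by positivity
    linarith
  have t6 : Real.exp (-√(m * (10 * L)) ^ 2 / (2 * (m * ((1 : NNReal) : ℝ)))) ≤ p := by
    refine le_of_eq_of_le ?_ htail
    rw [Real.sq_sqrt (by positivity)]
    congr 1
    simp only [NNReal.coe_one]
    field_simp
    ring
  have hnp : n * p ≤ δ / 8 := by
    rw [hp, ← mul_div_assoc, div_le_div_iff₀ (by positivity) (by norm_num)]
    nlinarith [mul_nonneg hδ.le (by linarith : (0 : ℝ) ≤ n)]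
  have hnnp : (n : ℝ) * n * p = δ / 8 := by
    rw [hp]
    field_simp
  have p3 : (initLaw d m α).real (⋃ i, B3 i) ≤ δ / 8 := by
    have q : ∀ i, (initLaw d m α).real (B3 i) ≤ p := fun i => by
      refine (initLaw_bounded_sum_ge_le (hFm i) (a := 0) (fun b => ?_) hρ0).trans t3
      simp only [F, Set.indicator_apply]
      split_ifs <;> simp
    refine (measureReal_iUnion_le_card_mul q).trans ?_
    rwa [Fintype.card_fin]
  have p4 : (initLaw d m α).real (⋃ i, B4 i) ≤ δ / 8 := by
    have q : ∀ i, (initLaw d m α).real (B4 i) ≤ p := fun i => by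
      refine (initLaw_bounded_sum_ge_le (hKm i.1 i.2) (a := 0) (fun b => ?_)
        (by positivity)).trans t4
      rw [zero_add]
      exact alignedKernel_mem_Icc (hx1 _) (hx1 _) b
    refine (measureReal_iUnion_le_card_mul q).trans ?_
    rw [Fintype.card_prod, Fintype.card_fin, Nat.cast_mul, hnnp]
  have p5 : (initLaw d m α).real (⋃ i, B5 i) ≤ δ / 8 := by
    have q : ∀ i, (initLaw d m α).real (B5 i) ≤ p := fun i => by
      refine (initLaw_bounded_sum_ge_le (hKm i.1 i.2).neg (a := -1) (fun b => ?_)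
        (by positivity)).trans t4
      have := alignedKernel_mem_Icc (hx1 i.1) (hx1 i.2) b
      exact ⟨by simpa using this.2, by simpa using this.1⟩
    refine (measureReal_iUnion_le_card_mul q).trans ?_
    rw [Fintype.card_prod, Fintype.card_fin, Nat.cast_mul, hnnp]
  have p6 : (initLaw d m α).real (⋃ i, B6 i) ≤ δ / 8 := by
    have q : ∀ i, (initLaw d m α).real (B6 i) ≤ p := fun i =>
      (initLaw_sum_ge_le (hasSubgaussianMGF_sign_mul_relu hα0.ne' (hx1 i)) (hSm i)
        (Real.sqrt_nonneg _)).trans t6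
    refine (measureReal_iUnion_le_card_mul q).trans ?_
    rwa [Fintype.card_fin]
  have p7 : (initLaw d m α).real (⋃ i, B7 i) ≤ δ / 8 := by
    have q : ∀ i, (initLaw d m α).real (B7 i) ≤ p := fun i =>
      (initLaw_sum_ge_le (hasSubgaussianMGF_sign_mul_relu hα0.ne' (hx1 i)).neg (hSm i).neg
        (Real.sqrt_nonneg _)).trans t6
    refine (measureReal_iUnion_le_card_mul q).trans ?_
    rwa [Fintype.card_fin]
  set Bad := (⋃ k, B1 k) ∪ ((⋃ k, B2 k) ∪ ((⋃ i, B3 i) ∪ ((⋃ i, B4 i) ∪ ((⋃ i, B5 i) ∪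
    ((⋃ i, B6 i) ∪ (⋃ i, B7 i)))))) with hBad
  have mBad : MeasurableSet Bad :=
    m1.union (m2.union (m3.union (m4.union (m5.union (m6.union m7)))))
  -- The total is `0 + δ/4 + 5 · δ/8 = 7δ/8`.
  have pBad : (initLaw d m α).real Bad ≤ δ := by
    refine (measureReal_union_le _ _).trans ?_
    have u2 := measureReal_union_le (μ := initLaw d m α) (⋃ k, B2 k) ((⋃ i, B3 i) ∪ ((⋃ i, B4 i) ∪
      ((⋃ i, B5 i) ∪ ((⋃ i, B6 i) ∪ (⋃ i, B7 i)))))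
    have u3 := measureReal_union_le (μ := initLaw d m α) (⋃ i, B3 i) ((⋃ i, B4 i) ∪
      ((⋃ i, B5 i) ∪ ((⋃ i, B6 i) ∪ (⋃ i, B7 i))))
    have u4 := measureReal_union_le (μ := initLaw d m α) (⋃ i, B4 i)
      ((⋃ i, B5 i) ∪ ((⋃ i, B6 i) ∪ (⋃ i, B7 i)))
    have u5 := measureReal_union_le (μ := initLaw d m α) (⋃ i, B5 i) ((⋃ i, B6 i) ∪ (⋃ i, B7 i))
    have u6 := measureReal_union_le (μ := initLaw d m α) (⋃ i, B6 i) (⋃ i, B7 i)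
    linarith
  refine ⟨Badᶜ, mBad.compl, ?_, fun ω hω => ?_⟩
  · rw [← ofReal_measureReal]
    refine ENNReal.ofReal_le_ofReal ?_
    rw [probReal_compl_eq_one_sub mBad]
    linarith
  simp only [hBad, Set.mem_compl_iff, Set.mem_union, Set.mem_iUnion, not_or, not_exists] at hω
  obtain ⟨w1, w2, w3, w4, w5, w6, w7⟩ := hω
  refine ⟨fun k => ?_, fun k => ?_, fun i => ?_, ?_, ?_⟩
  · simpa [B1] using w1 k
  · simpa only [B2, Set.mem_ofPred_eq, not_lt] using w2 k
  · have h1 := w3 i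
    simp only [B3, Set.mem_ofPred_eq, not_le] at h1
    have hEF : ∫ b, F i b ∂gaussian d α ≤ ρ := by
      simp only [F]
      rw [integral_indicator_const _ (hFs i), smul_eq_mul, mul_one]
      exact ENNReal.toReal_le_of_le_ofReal hρ0 (gaussian_abs_inner_le hα0 (hx i) ρ)
    have hcard : ((unstable α ρ x ω.1 i).card : ℝ) = ∑ k, F i (ω.1 k) := by
      simp [unstable, F, Set.indicator_apply]
    rw [Finset.sum_sub_distrib, Finset.sum_const, Finset.card_univ, Fintype.card_fin,
      nsmul_eq_mul] at h1
    have h2 := mul_le_mul_of_nonneg_left hEF hm0.le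
    -- The admissible fraction is `2ρ`: a mean of at most `ρ` plus a deviation of `ρ`.
    have h3 : μ / (1000 * n) * m = m * ρ + m * ρ := by rw [hρ]; field_simp; norm_num
    rw [hcard, h3]
    linarith
  · refine gramG_lower_of_entries hn hG fun i j => ?_
    have h1 := w4 (i, j)
    have h2 := w5 (i, j)
    simp only [B4, B5, Set.mem_ofPred_eq, not_le, integral_neg] at h1 h2
    rw [← gramGInf_apply] at h1 h2
    rw [Finset.sum_sub_distrib, Finset.sum_const, Finset.card_univ, Fintype.card_fin,
      nsmul_eq_mul] at h1 h2
    rw [Finset.sum_neg_distrib] at h2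
    have h3 : gramG x (initParams α ω.1) i j =
        1 / (m : ℝ) * ∑ k, alignedKernel (x i) (x j) (ω.1 k) := rfl
    rw [h3, one_div, abs_le]
    set s := ∑ k, alignedKernel (x i) (x j) (ω.1 k)
    have h4 : s = m * ((m : ℝ)⁻¹ * s) := by field_simp
    rw [h4] at h1 h2
    constructor
    · refine le_of_mul_le_mul_left ?_ hm0
      linarith
    · refine le_of_mul_le_mul_left ?_ hm0
      linarith
  · refine norm_le_sqrt_mul (by positivity) fun i => ?_
    have h1 := w6 i
    have h2 := w7 i
    simp only [B6, B7, S, Set.mem_ofPred_eq, not_le, Finset.sum_neg_distrib] at h1 h2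
    rw [PiLp.sub_apply, predictions_initParams hα0]
    refine (abs_sub _ _).trans (add_le_add ?_ (hy i))
    rw [abs_mul, abs_of_nonneg (by positivity : 0 ≤ 1 / √(m : ℝ)), one_div,
      inv_mul_le_iff₀ (Real.sqrt_pos.2 hm0), ← Real.sqrt_mul hm0.le, abs_le]
    constructor <;> linarith

end GoodEvent

/-! ### From the width condition to the regime of constants -/

section Width

variable {n m : ℕ} {α K L μ M Q : ℝ}

/-- Here `R` is at most `3nQ√L/(√m μ)`. The first width bound makes `KR` small, giving `R ≤ τ`. The
second makes `KnR ≤ α²μ/4000`, exactly what the conditions on relative displacement and on `ρ`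
require. The constant is `144000000 = 12000²`, with `12000 = 3 · 4000`. -/
theorem regime_of_width (hn : 1 ≤ n) (hm : 1 ≤ m) (hα : 1 ≤ α) (hK : 1 ≤ K) (hμ : 0 < μ)
    (hμ1 : μ ≤ 1) (hL : 1 / 4 ≤ L) (hM : 0 ≤ M) (hQ : 4 + 2 * M ≤ Q)
    (h1 : 144000000 * Q ^ 2 * K ^ 2 * (n ^ 2 * L) ≤ m * μ ^ 2)
    (h2 : 144000000 * Q ^ 2 * K ^ 2 * (n ^ 4 * L) ≤ m * (α ^ 4 * μ ^ 4)) :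
    Regime n m α (1 / (4 * K)) (μ / (2000 * n)) (μ / (1000 * n)) μ
      (3 * √n / (√m * μ) * (√n * (√(10 * L) + M))) := by
  have hn0 : (1 : ℝ) ≤ n := by exact_mod_cast hn
  have hm0 : (0 : ℝ) < m := by exact_mod_cast hm
  have hQ0 : 0 < Q := by linarith
  have hsm : 0 < √(m : ℝ) := Real.sqrt_pos.2 hm0
  have hsL : 1 / 2 ≤ √L := Real.le_sqrt_of_sq_le (by linarith)
  have hL0 : 0 ≤ L := by linarith
  have hU : √(10 * L) + M ≤ Q * √L := by
    have h3 : √(10 * L) ≤ 4 * √L := by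
      rw [show (4 : ℝ) * √L = √(16 * L) by
        rw [Real.sqrt_mul (by norm_num), show (16 : ℝ) = 4 ^ 2 by norm_num,
          Real.sqrt_sq (by norm_num)]]
      exact Real.sqrt_le_sqrt (by linarith)
    have h4 : M ≤ 2 * M * √L := by nlinarith
    calc √(10 * L) + M ≤ 4 * √L + 2 * M * √L := add_le_add h3 h4
      _ = (4 + 2 * M) * √L := by ring
      _ ≤ _ := by gcongr
  have e1 : 12000 * Q * K * n * √L ≤ √m * μ := by
    refine le_of_pow_le_pow_left₀ two_ne_zero (by positivity) ?_
    rw [mul_pow √(m : ℝ), Real.sq_sqrt hm0.le, mul_pow _ √L, Real.sq_sqrt hL0]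
    refine le_trans (le_of_eq ?_) h1
    ring
  have e2 : 12000 * Q * K * n ^ 2 * √L ≤ √m * (α ^ 2 * μ ^ 2) := by
    refine le_of_pow_le_pow_left₀ two_ne_zero (by positivity) ?_
    rw [mul_pow √(m : ℝ), Real.sq_sqrt hm0.le, mul_pow _ √L, Real.sq_sqrt hL0]
    refine le_trans (le_of_eq_of_le ?_ h2) (le_of_eq ?_) <;> ring
  set R := 3 * √n / (√m * μ) * (√n * (√(10 * L) + M)) with hR
  have hR0 : 0 ≤ R := by positivity
  have hR1 : R ≤ 3 * n * (Q * √L) / (√m * μ) := by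
    have h3 : R = 3 * (√n * √n) * (√(10 * L) + M) / (√m * μ) := by rw [hR]; ring
    rw [h3, Real.mul_self_sqrt (Nat.cast_nonneg n)]
    gcongr
  rw [le_div_iff₀ (by positivity)] at hR1
  have hsμ : 0 < √m * μ := by positivity
  have f1 : K * R ≤ 1 / 4000 := by
    refine le_of_mul_le_mul_right ?_ hsμ
    have := mul_le_mul_of_nonneg_left hR1 (by linarith : 0 ≤ K)
    linarith
  have f2 : K * (n * R) ≤ α ^ 2 * μ / 4000 := by
    refine le_of_mul_le_mul_right ?_ hsμ
    have := mul_le_mul_of_nonneg_left hR1 (by positivity : 0 ≤ K * n)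
    linarith
  have hα2 : 0 < α ^ 2 := by positivity
  have f3 : n * R ≤ K * (n * R) := le_mul_of_one_le_left (by positivity) hK
  refine ⟨hn, hm, hα, by positivity, hμ, hμ1, hR0, ?_, ?_, ?_, ?_⟩
  · rw [le_div_iff₀ (by positivity)]
    linarith
  · have : n * (R / (α ^ 2 * (1 / (4 * K)))) = 4 * (K * (n * R)) / α ^ 2 := by field_simp
    rw [this, div_le_iff₀ hα2]
    linarith
  · refine le_of_eq ?_
    field_simp
  · rw [div_le_div_iff₀ hα2 (by positivity)]
    linarith

end Width

end WeightNorm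

end

/-! ### The main theorem: choice of constants -/

theorem mainTheorem2 :
    ∃ c₀ : ℝ, 0 < c₀ ∧ ∀ M κ : ℝ, 0 < κ → ∃ C : ℝ, 0 < C ∧
      ∀ (n d m : ℕ) (α δ K μ₀ : ℝ) (x : Fin n → EuclideanSpace ℝ (Fin d))
        (y : EuclideanSpace ℝ (Fin n)),
        1 ≤ n → 50 ≤ d → 1 ≤ α → 0 < δ → δ < 1 → 2 * δ ≤ n →
        (∀ i, ‖x i‖ ≤ 1) → (∀ i, x i ≠ 0) →
        (∀ i j, i ≠ j → ∀ β : ℝ, β ≠ 0 → x i ≠ β • x j) →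
        (∀ i, |y i| ≤ M) →
        1 ≤ K → ((m : ℝ) / δ) ^ (1 / (d : ℝ)) ≤ K →
        μ₀ = WeightNorm.leastEigenvalue (WeightNorm.gramGInf α x) →
        0 < μ₀ ∧ 1 ≤ √((n : ℝ) / μ₀) ∧
        ((C * K ^ 2 * max ((n : ℝ) ^ 4 * Real.log (n / δ) / (α ^ 4 * μ₀ ^ 4))
              ((n : ℝ) ^ 2 * Real.log (n / δ) / μ₀ ^ 2) ≤ m ∨
            (κ * √((n : ℝ) / μ₀) ≤ α ∧
              C * K ^ 2 * ((n : ℝ) ^ 2 * Real.log (n / δ) / μ₀ ^ 2) ≤ m)) →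
          ∃ A : Set ((Fin m → EuclideanSpace ℝ (Fin d)) × (Fin m → ℝ)),
            MeasurableSet A ∧
            ENNReal.ofReal (1 - δ) ≤ WeightNorm.initLaw d m α A ∧
            ∀ ω ∈ A, ∀ η : ℝ, 0 < η →
              η * WeightNorm.spectralNorm
                (WeightNorm.evolution α x ω.2 (WeightNorm.initParams α ω.1)) ≤ c₀ →
              ∀ s : ℕ,
                μ₀ / 2 ≤ WeightNorm.leastEigenvalue
                  (WeightNorm.evolution α x ω.2 (WeightNorm.iter α η x y ω.1 ω.2 s)) ∧
                ‖WeightNorm.predictions x ω.2 (WeightNorm.iter α η x y ω.1 ω.2 s) - y‖ ^ 2 ≤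
                  (1 - η * μ₀ / 2) ^ s *
                    ‖WeightNorm.predictions x ω.2 (WeightNorm.iter α η x y ω.1 ω.2 0) - y‖ ^ 2) := by
  -- Along the trajectory `‖Λ‖` is at most 10 times its initial value, so `1/20` keeps `η‖Λ‖ ≤ 1/2`.
  refine ⟨1 / 20, by norm_num, fun M κ hκ => ?_⟩
  have hQ0 : (0 : ℝ) < 4 + 2 * |M| := by positivity
  -- `4 + 2|M|` bounds the initial outputs and labels in units of `√L`; `1/κ⁴` is needed only for
  -- the alternative with large `α`.
  refine ⟨144000000 * (4 + 2 * |M|) ^ 2 * (1 + 1 / κ ^ 4), by positivity, ?_⟩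
  intro n d m α δ K μ₀ x y hn hd hα hδ hδ1 h2δ hx1 hx hpar hy hK hmK hμ₀
  have hα0 : 0 < α := one_pos.trans_le hα
  have hn0 : (1 : ℝ) ≤ n := by exact_mod_cast hn
  have hμ : 0 < μ₀ := hμ₀ ▸ WeightNorm.leastEigenvalue_gramGInf_pos hn hα0.ne' hx1 hx hpar
  have hμ1 : μ₀ ≤ 1 := hμ₀ ▸ WeightNorm.leastEigenvalue_gramGInf_le_one hn hx1
  refine ⟨hμ, ?_, fun hwidth => ?_⟩
  · rw [Real.one_le_sqrt, le_div_iff₀ hμ]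
    linarith
  have hL : 1 / 4 ≤ Real.log (n / δ) := by
    have h2 : (2 : ℝ) ≤ n / δ := by rwa [le_div_iff₀ hδ]
    have := Real.log_le_log two_pos h2
    linarith [Real.log_two_gt_d9]
  set L := Real.log (n / δ) with hLdef
  set Q := 4 + 2 * |M| with hQ
  have hQ16 : 16 ≤ Q ^ 2 := by nlinarith [abs_nonneg M]
  have hC : 144000000 * Q ^ 2 ≤ 144000000 * Q ^ 2 * (1 + 1 / κ ^ 4) :=
    le_mul_of_one_le_right (by positivity) (le_add_of_nonneg_right (by positivity))
  have hκC : 144000000 * Q ^ 2 * (1 / κ ^ 4) ≤ 144000000 * Q ^ 2 * (1 + 1 / κ ^ 4) := by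
    gcongr
    linarith
  set C := 144000000 * Q ^ 2 * (1 + 1 / κ ^ 4) with hCdef
  have hL0 : 0 < L := by linarith
  have h1 : 144000000 * Q ^ 2 * K ^ 2 * (n ^ 2 * L) ≤ m * μ₀ ^ 2 := by
    have h : C * K ^ 2 * (n ^ 2 * L / μ₀ ^ 2) ≤ m := by
      rcases hwidth with h | ⟨-, h⟩
      · refine le_trans ?_ h
        gcongr
        exact le_max_right _ _
      · exact h
    rw [← mul_div_assoc, div_le_iff₀ (by positivity)] at h
    refine le_trans ?_ h
    gcongr
  have h2 : 144000000 * Q ^ 2 * K ^ 2 * (n ^ 4 * L) ≤ m * (α ^ 4 * μ₀ ^ 4) := by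
    rcases hwidth with h | ⟨hκα, h⟩
    · have h3 : C * K ^ 2 * (n ^ 4 * L / (α ^ 4 * μ₀ ^ 4)) ≤ m := by
        refine le_trans ?_ h
        gcongr
        exact le_max_left _ _
      rw [← mul_div_assoc, div_le_iff₀ (by positivity)] at h3
      refine le_trans ?_ h3
      gcongr
    -- For `α ≥ κ√(n/μ₀)` one has `n⁴/(α⁴μ₀⁴) ≤ κ⁻⁴ n²/μ₀²`, so the weaker width assumption already
    -- implies the stronger bound.
    · have h4 : κ ^ 4 * (n ^ 2 / μ₀ ^ 2) ≤ α ^ 4 := by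
        have h5 := pow_le_pow_left₀ (by positivity) hκα 4
        have h6 : √(n / μ₀) ^ 4 = n ^ 2 / μ₀ ^ 2 := by
          rw [show √(n / μ₀) ^ 4 = (√(n / μ₀) ^ 2) ^ 2 by ring, Real.sq_sqrt (by positivity),
            div_pow]
        rwa [mul_pow, h6] at h5
      have h7 : 144000000 * Q ^ 2 * (1 / κ ^ 4) * K ^ 2 * (n ^ 2 * L / μ₀ ^ 2) ≤ m := by
        refine le_trans ?_ h
        gcongr
      calc 144000000 * Q ^ 2 * K ^ 2 * (n ^ 4 * L)
          = 144000000 * Q ^ 2 * (1 / κ ^ 4) * K ^ 2 * (n ^ 2 * L / μ₀ ^ 2) *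
            (κ ^ 4 * (n ^ 2 / μ₀ ^ 2) * μ₀ ^ 4) := by field_simp
        _ ≤ m * (α ^ 4 * μ₀ ^ 4) := by gcongr
  have hm : 1 ≤ m := by
    rcases Nat.eq_zero_or_pos m with rfl | h
    · exfalso
      have : 0 < 144000000 * Q ^ 2 * K ^ 2 * (n ^ 2 * L) := by positivity
      simp only [Nat.cast_zero, zero_mul] at h1
      linarith
    · exact h
  have h3 : 10000000 * n ^ 2 * L ≤ m * μ₀ ^ 2 := by
    refine le_trans ?_ h1
    have hK2 : 1 ≤ K ^ 2 := one_le_pow₀ hK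
    calc 10000000 * n ^ 2 * L ≤ 144000000 * 16 * 1 * (n ^ 2 * L) := by
          have : 0 ≤ (n : ℝ) ^ 2 * L := by positivity
          linarith
      _ ≤ _ := by gcongr
  have hM : 0 ≤ M := (abs_nonneg _).trans (hy ⟨0, hn⟩)
  have hreg := WeightNorm.regime_of_width hn hm hα hK hμ hμ1 hL hM
    (by rw [hQ, abs_of_nonneg hM]) h1 h2
  obtain ⟨A, hAm, hAp, hA⟩ := WeightNorm.exists_goodInit_event hn (by omega) hm hα hδ hδ1 h2δ hx1 hx
    hy hK hmK hμ (fun a => by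
      rw [hμ₀]
      exact WeightNorm.leastEigenvalue_mul_le (WeightNorm.isHermitian_gramGInf x) a) h3
  exact ⟨A, hAm, hAp, fun ω hω η hη hηΛ s => (hA ω hω).converges hreg hx1 hη hηΛ s⟩
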